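/- Fix $p\in(0,1)$ and let $(X_i)_{i\ge 1}$ be the Markov chain with states $0$ and $1$, transition matrix $\begin{pmatrix}p & 1-p\\ 1 & 0\end{pmatrix}$ and initial distribution $\mathrm{Prob}(X_1=0)=\frac{1}{2-p}$, $\mathrm{Prob}(X_1=1)=\frac{1-p}{2-p}$. For $\beta_0,\beta_1\in(0,1)$ let the nonuniform Markov geometric measure $\mu_{\beta_0,\beta_1,p}$ be the distribution on $\mathbb{R}$ of the random series $$S=\sum_{i=1}^{\infty}X_i\,\beta_1^{\hat X_i}\,\beta_0^{\,i-\hat X_i},\qquad \hat X_i=\sum_{k=1}^{i}X_k .$$ Then, with respect to two-dimensional Lebesgue measure: 1. for almost all $(\beta_0,\beta_1)\in(0,0.739)^2$ with $\beta_0\beta_1^{1-p}>p^p(1-p)^{1-p}$, the measure $\mu_{\beta_0,\beta_1,p}$ is absolutely continuous with respect to Lebesgue measure on $\mathbb{R}$; 2. for almost all $(\beta_0,\beta_1)\in(0,0.739)^2$ with $(\beta_0-p^2)\beta_1>(1-p)^2$, the measure $\mu_{\beta_0,\beta_1,p}$ has a density in $L^2(\mathbb{R})$ with respect to Lebesgue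 measure. -/

import Mathlib

open MeasureTheory ProbabilityTheory

namespace MarkovGeometric

/-- The transition matrix of the Markov chain with states `0` and `1`; the entry `(a, b)` is the
probability of a step from `a` to `b`. -/
def transitionMatrix (p : ℝ) : Matrix (Fin 2) (Fin 2) ℝ :=
  !![p, 1 - p; 1, 0]

/-- The initial probability vector of the chain. -/
noncomputable def initialVector (p : ℝ) : Fin 2 → ℝ :=
  ![1 / (2 - p), (1 - p) / (2 - p)]

/-- The measure on the two states giving the state `j` the mass `w j`. -/
noncomputable def weightMeasure (w : Fin 2 → ℝ) : Measure (Fin 2) :=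
  ∑ j : Fin 2, ENNReal.ofReal (w j) • Measure.dirac j

theorem isProbabilityMeasure_weightMeasure (w : Fin 2 → ℝ) (h0 : 0 ≤ w 0) (h1 : 0 ≤ w 1)
    (h : w 0 + w 1 = 1) : IsProbabilityMeasure (weightMeasure w) := by
  refine ⟨?_⟩
  simp [weightMeasure, Fin.sum_univ_two, ← ENNReal.ofReal_add h0 h1, h]

/-- The transition kernel at time `n`: the next state is drawn from the row of the transition matrix
indexed by the current state `x n`, whatever the earlier states were. -/
noncomputable def stepKernel (p : Set.Ioo (0 : ℝ) 1) (n : ℕ) :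
    Kernel ((_ : Finset.Iic n) → Fin 2) (Fin 2) where
  toFun x := weightMeasure fun b => transitionMatrix p (x ⟨n, Finset.mem_Iic.2 le_rfl⟩) b
  measurable' := measurable_of_finite _

instance (p : Set.Ioo (0 : ℝ) 1) (n : ℕ) : IsMarkovKernel (stepKernel p n) := by
  refine ⟨fun x => ?_⟩
  have hp := p.2
  change IsProbabilityMeasure
    (weightMeasure fun b => transitionMatrix p (x ⟨n, Finset.mem_Iic.2 le_rfl⟩) b)
  generalize x ⟨n, Finset.mem_Iic.2 le_rfl⟩ = a
  fin_cases a <;> apply isProbabilityMeasure_weightMeasure <;>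
    simp [transitionMatrix, hp.1.le, hp.2.le]

/-- The law on `{0,1}^ℕ` of the Markov chain with the above transition matrix and initial vector.
Sequences are indexed from `0`: the coordinate `k` is the `(k+1)`-st variable of the chain. -/
noncomputable def chainLaw (p : Set.Ioo (0 : ℝ) 1) : Measure (ℕ → Fin 2) :=
  Kernel.trajMeasure (X := fun _ => Fin 2) (weightMeasure (initialVector p)) (stepKernel p)

instance (p : Set.Ioo (0 : ℝ) 1) : IsProbabilityMeasure (chainLaw p) := by
  have hp := p.2
  have h2 : (0 : ℝ) < 2 - p := by linarith [hp.2]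
  have : IsProbabilityMeasure (weightMeasure (initialVector p)) := by
    apply isProbabilityMeasure_weightMeasure
    · simpa [initialVector] using h2.le
    · simpa [initialVector] using div_nonneg (by linarith [hp.2]) h2.le
    · simp only [initialVector, Matrix.cons_val_zero, Matrix.cons_val_one]
      field_simp
      ring
  unfold chainLaw
  infer_instance

/-- The number of ones among the first `i` entries of the sequence `x`. -/
def countOnes (x : ℕ → Fin 2) (i : ℕ) : ℕ :=
  ∑ k ∈ Finset.range i, (x k : ℕ)

theorem countOnes_le (x : ℕ → Fin 2) (i : ℕ) : countOnes x i ≤ i := by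
  unfold countOnes
  calc ∑ k ∈ Finset.range i, (x k : ℕ) ≤ ∑ _k ∈ Finset.range i, 1 :=
        Finset.sum_le_sum fun k _ => Nat.le_of_lt_succ (x k).2
    _ = i := by simp

/-- The random power series `∑_{i ≥ 1} X_i β₁ ^ N_i β₀ ^ (i - N_i)`, where `N_i` is the number of
ones among `X_1, …, X_i`. The summand `n` below is the one with `i = n + 1`. -/
noncomputable def series (β₀ β₁ : ℝ) (x : ℕ → Fin 2) : ℝ :=
  ∑' n : ℕ, ((x n : ℕ) : ℝ) * β₁ ^ countOnes x (n + 1) * β₀ ^ (n + 1 - countOnes x (n + 1))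

theorem summand_bound (β₀ β₁ : ℝ) (h₀ : β₀ ∈ Set.Ioo (0 : ℝ) 1) (h₁ : β₁ ∈ Set.Ioo (0 : ℝ) 1)
    (x : ℕ → Fin 2) (n : ℕ) :
    ‖((x n : ℕ) : ℝ) * β₁ ^ countOnes x (n + 1) * β₀ ^ (n + 1 - countOnes x (n + 1))‖
      ≤ max β₀ β₁ ^ (n + 1) := by
  have hx : ((x n : ℕ) : ℝ) ≤ 1 := by exact_mod_cast Nat.le_of_lt_succ (x n).2
  have hc := countOnes_le x (n + 1)
  have hm : 0 ≤ max β₀ β₁ := h₀.1.le.trans (le_max_left _ _)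
  have a1 := pow_le_pow_left₀ h₁.1.le (le_max_right β₀ β₁) (countOnes x (n + 1))
  have a0 := pow_le_pow_left₀ h₀.1.le (le_max_left β₀ β₁) (n + 1 - countOnes x (n + 1))
  have p1 := pow_nonneg h₁.1.le (countOnes x (n + 1))
  have p0 := pow_nonneg h₀.1.le (n + 1 - countOnes x (n + 1))
  rw [Real.norm_of_nonneg (by positivity)]
  calc _ ≤ 1 * max β₀ β₁ ^ countOnes x (n + 1) *
        max β₀ β₁ ^ (n + 1 - countOnes x (n + 1)) := by gcongr
    _ = max β₀ β₁ ^ (n + 1) := by rw [one_mul, ← pow_add, Nat.add_sub_cancel' hc]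

/-- The series converges for all parameters in `(0,1)` and defines a measurable map, so that its law
below is a genuine pushforward. -/
theorem summable_series (β₀ β₁ : ℝ) (h₀ : β₀ ∈ Set.Ioo (0 : ℝ) 1) (h₁ : β₁ ∈ Set.Ioo (0 : ℝ) 1)
    (x : ℕ → Fin 2) : Summable fun n : ℕ =>
      ((x n : ℕ) : ℝ) * β₁ ^ countOnes x (n + 1) * β₀ ^ (n + 1 - countOnes x (n + 1)) :=
  Summable.of_norm_bounded ((summable_nat_add_iff 1).2 (summable_geometric_of_lt_one
    (h₀.1.le.trans (le_max_left _ _)) (max_lt h₀.2 h₁.2))) (summand_bound β₀ β₁ h₀ h₁ x)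

theorem measurable_series (β₀ β₁ : ℝ) (h₀ : β₀ ∈ Set.Ioo (0 : ℝ) 1)
    (h₁ : β₁ ∈ Set.Ioo (0 : ℝ) 1) : Measurable (series β₀ β₁) := by
  have hcount : ∀ i, Measurable fun x : ℕ → Fin 2 => countOnes x i := fun i =>
    Finset.measurable_sum _ fun k _ => (measurable_of_finite _).comp (measurable_pi_apply k)
  have hterm : ∀ n, Measurable fun x : ℕ → Fin 2 =>
      ((x n : ℕ) : ℝ) * β₁ ^ countOnes x (n + 1) * β₀ ^ (n + 1 - countOnes x (n + 1)) := by
    intro n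
    have e1 : Measurable fun x : ℕ → Fin 2 => ((x n : ℕ) : ℝ) :=
      (measurable_of_finite fun a : Fin 2 => ((a : ℕ) : ℝ)).comp (measurable_pi_apply n)
    have e2 : Measurable fun x : ℕ → Fin 2 => β₁ ^ countOnes x (n + 1) :=
      (measurable_from_nat (f := fun m => β₁ ^ m)).comp (hcount (n + 1))
    have e3 : Measurable fun x : ℕ → Fin 2 => β₀ ^ (n + 1 - countOnes x (n + 1)) :=
      (measurable_from_nat (f := fun m => β₀ ^ (n + 1 - m))).comp (hcount (n + 1))
    exact (e1.mul e2).mul e3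
  refine measurable_of_tendsto_metrizable
    (fun N => Finset.measurable_sum (Finset.range N) fun n _ => hterm n) ?_
  rw [tendsto_pi_nhds]
  intro x
  simpa [series] using (summable_series β₀ β₁ h₀ h₁ x).hasSum.tendsto_sum_nat

/-- The nonuniform Markov geometric measure: the distribution on the real line of the random power
series along the Markov chain. -/
noncomputable def markovGeometricMeasure (β₀ β₁ : ℝ) (p : Set.Ioo (0 : ℝ) 1) : Measure ℝ :=
  (chainLaw p).map (series β₀ β₁)

theorem isProbabilityMeasure_markovGeometricMeasure (β₀ β₁ : ℝ) (h₀ : β₀ ∈ Set.Ioo (0 : ℝ) 1)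
    (h₁ : β₁ ∈ Set.Ioo (0 : ℝ) 1) (p : Set.Ioo (0 : ℝ) 1) :
    IsProbabilityMeasure (markovGeometricMeasure β₀ β₁ p) :=
  Measure.isProbabilityMeasure_map (measurable_series β₀ β₁ h₀ h₁).aemeasurable

/-- `μ` has a density in `L²` with respect to Lebesgue measure. -/
def HasL2Density (μ : Measure ℝ) : Prop :=
  ∃ f : ℝ → ℝ, 0 ≤ f ∧ MemLp f 2 volume ∧
    μ = volume.withDensity fun x => ENNReal.ofReal (f x)

end MarkovGeometric

open MeasureTheory ProbabilityTheory

namespace MarkovGeometric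

/-! The proof is a transversality argument in the style of Peres and Solomyak. The chain never steps
from 1 to 1, so almost every path is `Admissible`. Along a ray of parameters, the difference of the
series of two admissible paths with different first letters is, after normalisation, a power series
f with constant term 1, coefficients in [-1, 1] and, because ones are never adjacent, sums of
neighbouring coefficients in [-1, 1]. This makes (1 + t) f(t) / t ^ 6 decrease at a definite rate up
to t = 0.739 (`transversality`), so the parameters on a ray at which the two images are within r of
each other form a set of diameter O(r). Self-similarity extends this to paths that first differ at
letter n, at the cost of dividing by the weight of the common prefix, and polar coordinates turn it
into the area bound `volume_near_le`.

Write μ for the law of the series. Average (μ(B(x, r)) / 2r) ^ s, with 0 < s ≤ 1, over x with law μ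
and over the parameters in a square with lower corner c. Exchanging the integrals, splitting at the
first disagreement and using concavity of the power bounds this, uniformly in r, by a multiple of
the sum over n of the s-th moments of `massRatio`. These moments are governed by powers of the
matrix P i j ^ (1 + s) / c j ^ s, hence are summable when `charSum` is below one
(`tsum_massRatio_lt_top`). By Fatou, almost every μ has a lower density with finite s-th moment
under μ (`ae_lintegral_liminf_lt_top`). Finiteness of the lower density gives absolute continuity;
for s = 1 the moment is the squared L² norm of the density.

At s = 0 the characteristic sum equals 1, and the entropy condition says that its derivative there
is negative, so some small s works. At s = 1, being below one is the second condition. Countably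
many squares with rational lower corners exhaust the parameters. -/

/-! ### The transversality inequality for power series -/

/-- The extremal function, divided by `u ^ 6`, in the transversality estimate. -/
noncomputable def starFunction (u : ℝ) : ℝ :=
  (u ^ 6)⁻¹ - (u ^ 4)⁻¹ - (u ^ 3)⁻¹ - (u ^ 2)⁻¹ - u⁻¹ + u / (1 - u)

theorem hasDerivAt_starFunction {u : ℝ} (h0 : 0 < u) (h1 : u < 1) :
    HasDerivAt starFunction
      (-6 / u ^ 7 + 4 / u ^ 5 + 3 / u ^ 4 + 2 / u ^ 3 + 1 / u ^ 2 + 1 / (1 - u) ^ 2) u := by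
  have hu : u ≠ 0 := h0.ne'
  have hu' : 1 - u ≠ 0 := by linarith
  have e := ((((((hasDerivAt_pow 6 u).inv (pow_ne_zero _ hu)).sub
    ((hasDerivAt_pow 4 u).inv (pow_ne_zero _ hu))).sub
    ((hasDerivAt_pow 3 u).inv (pow_ne_zero _ hu))).sub
    ((hasDerivAt_pow 2 u).inv (pow_ne_zero _ hu))).sub (hasDerivAt_inv hu)).add
    ((hasDerivAt_id u).div ((hasDerivAt_id u).const_sub 1) hu')
  refine e.congr_deriv ?_
  simp only [id]
  field_simp
  push_cast
  ring

/-- After bounding the last term by its value at 0.739 and multiplying by u ^ 7, all non-constant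
terms increase in u, so only the endpoint matters. The constant 0.739 comes from here: the
derivative is already positive at 0.74. -/
theorem deriv_starFunction_le {u : ℝ} (h0 : 0 < u) (h1 : u ≤ 0.739) :
    -6 / u ^ 7 + 4 / u ^ 5 + 3 / u ^ 4 + 2 / u ^ 3 + 1 / u ^ 2 + 1 / (1 - u) ^ 2 ≤ -0.01 := by
  have hw : (1 - u) ^ 2 ≥ 0.261 ^ 2 := by gcongr; linarith
  have hw' : 1 / (1 - u) ^ 2 ≤ 1 / 0.261 ^ 2 := by gcongr
  have h : -6 + 4 * u ^ 2 + 3 * u ^ 3 + 2 * u ^ 4 + u ^ 5 + u ^ 7 * (1 / 0.261 ^ 2)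
      + 0.01 * u ^ 7 ≤ 0 := by
    calc _ ≤ -6 + 4 * 0.739 ^ 2 + 3 * 0.739 ^ 3 + 2 * 0.739 ^ 4 + 0.739 ^ 5
        + 0.739 ^ 7 * (1 / 0.261 ^ 2) + 0.01 * (0.739 : ℝ) ^ 7 := by gcongr
      _ ≤ 0 := by norm_num
  have key : (-6 + 4 * u ^ 2 + 3 * u ^ 3 + 2 * u ^ 4 + u ^ 5 + u ^ 7 * (1 / 0.261 ^ 2)
      + 0.01 * u ^ 7) / u ^ 7 = -6 / u ^ 7 + 4 / u ^ 5 + 3 / u ^ 4 + 2 / u ^ 3 + 1 / u ^ 2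
        + 1 / 0.261 ^ 2 + 0.01 := by
    field_simp
  have := div_nonpos_of_nonpos_of_nonneg h (pow_nonneg h0.le 7)
  rw [key] at this
  linarith

theorem starFunction_sub {s t : ℝ} (hs : 0 < s) (hst : s ≤ t) (ht : t ≤ 0.739) :
    0.01 * (t - s) ≤ starFunction s - starFunction t := by
  have hd : ∀ u ∈ Set.Icc s t, HasDerivAt (fun u => starFunction u + 0.01 * u)
      (-6 / u ^ 7 + 4 / u ^ 5 + 3 / u ^ 4 + 2 / u ^ 3 + 1 / u ^ 2 + 1 / (1 - u) ^ 2 + 0.01) u := by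
    intro u hu
    have := (hasDerivAt_starFunction (u := u) (by linarith [hu.1]) (by linarith [hu.2])).add
      ((hasDerivAt_id u).const_mul 0.01)
    exact this.congr_deriv (by simp)
  have anti : AntitoneOn (fun u => starFunction u + 0.01 * u) (Set.Icc s t) := by
    refine antitoneOn_of_deriv_nonpos (convex_Icc s t)
      (fun u hu => (hd u hu).continuousAt.continuousWithinAt)
      (fun u hu => (hd u (interior_subset hu)).differentiableAt.differentiableWithinAt) ?_
    intro u hu
    have hu := interior_subset hu
    rw [(hd u hu).deriv]
    linarith [deriv_starFunction_le (u := u) (by linarith [hu.1]) (by linarith [hu.2])]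
  have := anti (Set.left_mem_Icc.2 hst) (Set.right_mem_Icc.2 hst) hst
  simp only at this
  linarith

/-- Multiplication by 1 + t replaces coefficients by sums of neighbours; for differences of
admissible paths these are still at most 1 in absolute value. -/
theorem one_add_mul_tsum {e : ℕ → ℝ} (he : ∀ n, |e n| ≤ 1) {t : ℝ} (h0 : 0 < t) (h1 : t < 1) :
    (1 + t) * ∑' n, e n * t ^ n = e 0 + ∑' n, (e n + e (n + 1)) * t ^ (n + 1) := by
  have hs : Summable fun n => e n * t ^ n := by
    refine Summable.of_norm_bounded (summable_geometric_of_lt_one h0.le h1) fun n => ?_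
    rw [norm_mul, Real.norm_eq_abs, Real.norm_of_nonneg (by positivity)]
    exact mul_le_of_le_one_left (by positivity) (he n)
  have h2 := hs.mul_left t
  have h3 := (summable_nat_add_iff 1).2 hs
  rw [add_mul, one_mul, ← tsum_mul_left]
  nth_rw 1 [hs.tsum_eq_zero_add]
  rw [pow_zero, mul_one, add_assoc, ← h3.tsum_add h2]
  congr 2
  ext n
  ring

/-- Transversality for the power series with coefficients `e`, in an integrated form. -/
theorem transversality {e : ℕ → ℝ} (he : ∀ n, |e n| ≤ 1) (h0 : e 0 = 1) (h1 : -1 ≤ e 1)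
    (h2 : ∀ n, |e n + e (n + 1)| ≤ 1) {s t : ℝ} (hs : 0 < s) (hst : s ≤ t) (ht : t ≤ 0.739) :
    0.01 * (t - s) ≤ (1 + s) * (∑' n, e n * s ^ n) / s ^ 6 -
      (1 + t) * (∑' n, e n * t ^ n) / t ^ 6 := by
  refine (starFunction_sub hs hst ht).trans ?_
  have ht0 : 0 < t := hs.trans_le hst
  have ht1 : t < 1 := by linarith
  have hs1 : s < 1 := by linarith
  rw [one_add_mul_tsum he hs hs1, one_add_mul_tsum he ht0 ht1, h0]
  set d : ℕ → ℝ := fun n => e n + e (n + 1) with hd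
  have hsum : ∀ u : ℝ, 0 < u → u < 1 → Summable fun n => d n * u ^ (n + 1) := by
    intro u hu0 hu1
    refine Summable.of_norm_bounded
      ((summable_nat_add_iff 1).2 (summable_geometric_of_lt_one hu0.le hu1)) fun n => ?_
    rw [norm_mul, Real.norm_eq_abs, Real.norm_of_nonneg (by positivity)]
    exact mul_le_of_le_one_left (by positivity) (h2 n)
  have hsplit : ∀ u : ℝ, 0 < u → u < 1 → (1 + ∑' n, d n * u ^ (n + 1)) / u ^ 6 =
      (u ^ 6)⁻¹ + d 0 * (u ^ 5)⁻¹ + d 1 * (u ^ 4)⁻¹ + d 2 * (u ^ 3)⁻¹ + d 3 * (u ^ 2)⁻¹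
        + d 4 * u⁻¹ + d 5 + ∑' n, d (n + 6) * u ^ (n + 1) := by
    intro u hu0 hu1
    rw [← (hsum u hu0 hu1).sum_add_tsum_nat_add 6]
    have : ∑' n, d (n + 6) * u ^ (n + 6 + 1) = u ^ 6 * ∑' n, d (n + 6) * u ^ (n + 1) := by
      rw [← tsum_mul_left]; congr 1; ext n; ring
    rw [this]
    simp only [Finset.sum_range_succ, Finset.sum_range_zero]
    field_simp
    ring
  have hsum6 : ∀ u : ℝ, 0 < u → u < 1 → Summable fun n => d (n + 6) * u ^ (n + 1) := by
    intro u hu0 hu1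
    refine Summable.of_norm_bounded
      ((summable_nat_add_iff 1).2 (summable_geometric_of_lt_one hu0.le hu1)) fun n => ?_
    rw [norm_mul, Real.norm_eq_abs, Real.norm_of_nonneg (by positivity)]
    exact mul_le_of_le_one_left (by positivity) (h2 _)
  have hgeom : ∀ u : ℝ, 0 < u → u < 1 → HasSum (fun n : ℕ => u ^ (n + 1)) (u / (1 - u)) := by
    intro u hu0 hu1
    simpa [pow_succ', div_eq_mul_inv] using (hasSum_geometric_of_lt_one hu0.le hu1).mul_left u
  -- After division by u ^ 6 the terms of degree at least 7 increase in u, so the extremal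
  -- coefficient is 1; the term of degree 6 is constant and cancels.
  have htail : s / (1 - s) - t / (1 - t) ≤
      ∑' n, d (n + 6) * s ^ (n + 1) - ∑' n, d (n + 6) * t ^ (n + 1) := by
    have a := (hgeom s hs hs1).sub (hgeom t ht0 ht1)
    have b := (hsum6 s hs hs1).hasSum.sub (hsum6 t ht0 ht1).hasSum
    refine hasSum_le (fun n => ?_) a b
    have hp : s ^ (n + 1) ≤ t ^ (n + 1) := by gcongr
    have := (abs_le.1 (h2 (n + 6))).2
    simp only [hd]
    nlinarith
  have hinv : ∀ k : ℕ, (t ^ k)⁻¹ ≤ (s ^ k)⁻¹ := fun k => by gcongr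
  -- Negative powers of u decrease, so here the extremal coefficient is -1.
  have hlow : ∀ n k : ℕ, -((s ^ k)⁻¹ - (t ^ k)⁻¹) ≤ d n * ((s ^ k)⁻¹ - (t ^ k)⁻¹) := by
    intro n k
    have := (abs_le.1 (h2 n)).1
    simp only [hd]
    nlinarith [hinv k]
  -- Since d 0 = 1 + e 1 is nonnegative, its term only helps; hence `starFunction` has no fifth
  -- inverse power.
  have h5 : 0 ≤ d 0 * ((s ^ 5)⁻¹ - (t ^ 5)⁻¹) :=
    mul_nonneg (by simp only [hd]; linarith) (sub_nonneg.2 (hinv 5))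
  rw [hsplit s hs hs1, hsplit t ht0 ht1]
  have l1 := hlow 1 4
  have l2 := hlow 2 3
  have l3 := hlow 3 2
  have l4 := hlow 4 1
  simp only [pow_one] at l4
  unfold starFunction
  linarith

/-! ### Path weights and self-similarity of the series -/

/-- The product of the contraction ratios along the first `n` letters of `x`. -/
noncomputable def pathWeight (b : Fin 2 → ℝ) (x : ℕ → Fin 2) (n : ℕ) : ℝ :=
  ∏ k ∈ Finset.range n, b (x k)

theorem pathWeight_succ (b : Fin 2 → ℝ) (x : ℕ → Fin 2) (n : ℕ) :
    pathWeight b x (n + 1) = pathWeight b x n * b (x n) :=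
  Finset.prod_range_succ _ _

theorem pathWeight_add (b : Fin 2 → ℝ) (x : ℕ → Fin 2) (m n : ℕ) :
    pathWeight b x (m + n) = pathWeight b x m * pathWeight b (fun k => x (m + k)) n :=
  Finset.prod_range_add _ _ _

theorem pathWeight_pos {b : Fin 2 → ℝ} (hb : ∀ i, 0 < b i) (x : ℕ → Fin 2) (n : ℕ) :
    0 < pathWeight b x n :=
  Finset.prod_pos fun _ _ => hb _

theorem pathWeight_le_one {b : Fin 2 → ℝ} (hb : ∀ i, 0 ≤ b i) (h1 : ∀ i, b i ≤ 1)
    (x : ℕ → Fin 2) (n : ℕ) : pathWeight b x n ≤ 1 :=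
  Finset.prod_le_one (fun _ _ => hb _) fun _ _ => h1 _

theorem pathWeight_mono {b c : Fin 2 → ℝ} (hb : ∀ i, 0 ≤ b i) (h : ∀ i, b i ≤ c i)
    (x : ℕ → Fin 2) (n : ℕ) : pathWeight b x n ≤ pathWeight c x n :=
  Finset.prod_le_prod (fun _ _ => hb _) fun _ _ => h _

theorem pathWeight_smul (b : Fin 2 → ℝ) (t : ℝ) (x : ℕ → Fin 2) (n : ℕ) :
    pathWeight (fun i => b i * t) x n = pathWeight b x n * t ^ n := by
  simp [pathWeight, Finset.prod_mul_distrib]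

theorem pathWeight_le_of_eq_one {b : Fin 2 → ℝ} (hb : ∀ i, 0 ≤ b i) (h1 : ∀ i, b i ≤ 1)
    {x : ℕ → Fin 2} {n : ℕ} (hx : x n = 1) : pathWeight b x (n + 1) ≤ b 1 := by
  rw [pathWeight_succ, hx]
  exact mul_le_of_le_one_left (hb 1) (pathWeight_le_one hb h1 x n)

theorem pathWeight_congr (b : Fin 2 → ℝ) {x y : ℕ → Fin 2} {n : ℕ} (h : ∀ k < n, x k = y k) :
    pathWeight b x n = pathWeight b y n :=
  Finset.prod_congr rfl fun k hk => by rw [h k (Finset.mem_range.1 hk)]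

theorem pathWeight_eq_pow (β₀ β₁ : ℝ) (x : ℕ → Fin 2) (n : ℕ) :
    pathWeight ![β₀, β₁] x n = β₁ ^ countOnes x n * β₀ ^ (n - countOnes x n) := by
  induction n with
  | zero => simp [pathWeight, countOnes]
  | succ n ih =>
    have hc := countOnes_le x n
    have hs : countOnes x (n + 1) = countOnes x n + (x n : ℕ) := Finset.sum_range_succ _ _
    rw [pathWeight_succ, ih, hs]
    generalize x n = a
    fin_cases a
    · simp [Nat.succ_sub hc, pow_succ, mul_assoc]
    · simp [pow_succ]
      ring

theorem summand_eq (β₀ β₁ : ℝ) (x : ℕ → Fin 2) (n : ℕ) :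
    ((x n : ℕ) : ℝ) * β₁ ^ countOnes x (n + 1) * β₀ ^ (n + 1 - countOnes x (n + 1)) =
      ((x n : ℕ) : ℝ) * pathWeight ![β₀, β₁] x (n + 1) := by
  rw [pathWeight_eq_pow, mul_assoc]

theorem series_eq_tsum (β₀ β₁ : ℝ) (x : ℕ → Fin 2) :
    series β₀ β₁ x = ∑' n : ℕ, ((x n : ℕ) : ℝ) * pathWeight ![β₀, β₁] x (n + 1) := by
  simp only [series, summand_eq]

theorem summable_pathWeight {β₀ β₁ : ℝ} (h₀ : β₀ ∈ Set.Ioo (0 : ℝ) 1)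
    (h₁ : β₁ ∈ Set.Ioo (0 : ℝ) 1) (x : ℕ → Fin 2) :
    Summable fun n : ℕ => ((x n : ℕ) : ℝ) * pathWeight ![β₀, β₁] x (n + 1) := by
  simpa only [summand_eq] using summable_series β₀ β₁ h₀ h₁ x

theorem series_eq_add_shift {β₀ β₁ : ℝ} (h₀ : β₀ ∈ Set.Ioo (0 : ℝ) 1)
    (h₁ : β₁ ∈ Set.Ioo (0 : ℝ) 1) (x : ℕ → Fin 2) (n : ℕ) :
    series β₀ β₁ x =
      ∑ m ∈ Finset.range n, ((x m : ℕ) : ℝ) * pathWeight ![β₀, β₁] x (m + 1) +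
        pathWeight ![β₀, β₁] x n * series β₀ β₁ (fun k => x (n + k)) := by
  rw [series_eq_tsum, ← (summable_pathWeight h₀ h₁ x).sum_add_tsum_nat_add n,
    series_eq_tsum, ← tsum_mul_left]
  congr 2
  ext m
  rw [show m + n + 1 = n + (m + 1) by ring, pathWeight_add, add_comm m n]
  ring

/-- A common prefix contributes equal partial sums and a common scaling factor, which reduces
everything to paths with different first letters. -/
theorem series_sub_series {β₀ β₁ : ℝ} (h₀ : β₀ ∈ Set.Ioo (0 : ℝ) 1)
    (h₁ : β₁ ∈ Set.Ioo (0 : ℝ) 1) {x y : ℕ → Fin 2} {n : ℕ} (h : ∀ k < n, x k = y k) :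
    series β₀ β₁ x - series β₀ β₁ y = pathWeight ![β₀, β₁] x n *
      (series β₀ β₁ (fun k => x (n + k)) - series β₀ β₁ (fun k => y (n + k))) := by
  rw [series_eq_add_shift h₀ h₁ x n, series_eq_add_shift h₀ h₁ y n, ← pathWeight_congr _ h]
  have : ∑ m ∈ Finset.range n, ((x m : ℕ) : ℝ) * pathWeight ![β₀, β₁] x (m + 1) =
      ∑ m ∈ Finset.range n, ((y m : ℕ) : ℝ) * pathWeight ![β₀, β₁] y (m + 1) := by
    refine Finset.sum_congr rfl fun m hm => ?_
    have hm := Finset.mem_range.1 hm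
    rw [h m hm, pathWeight_congr _ fun k hk => h k (by omega)]
  rw [this]
  ring

/-! ### Admissible paths and transversality along rays -/

/-- A path without two consecutive ones. -/
def Admissible (x : ℕ → Fin 2) : Prop :=
  ∀ n, x n = 1 → x (n + 1) = 0

theorem Admissible.shift {x : ℕ → Fin 2} (h : Admissible x) (n : ℕ) :
    Admissible fun k => x (n + k) :=
  fun k hk => h (n + k) hk

/-- The normalised weight of the `n`-th summand. -/
noncomputable def unitWeight (a : Fin 2 → ℝ) (x : ℕ → Fin 2) (n : ℕ) : ℝ :=
  ((x n : ℕ) : ℝ) * pathWeight a x (n + 1) / a 1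

theorem unitWeight_nonneg {a : Fin 2 → ℝ} (ha : ∀ i, 0 < a i) (x : ℕ → Fin 2) (n : ℕ) :
    0 ≤ unitWeight a x n :=
  div_nonneg (mul_nonneg (by positivity) (pathWeight_pos ha x _).le) (ha 1).le

theorem unitWeight_eq_zero {a : Fin 2 → ℝ} {x : ℕ → Fin 2} {n : ℕ} (h : x n = 0) :
    unitWeight a x n = 0 := by
  simp [unitWeight, h]

theorem unitWeight_le_one {a : Fin 2 → ℝ} (ha : ∀ i, 0 < a i) (h1 : ∀ i, a i ≤ 1)
    (x : ℕ → Fin 2) (n : ℕ) : unitWeight a x n ≤ 1 := by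
  rcases Fin.eq_zero_or_eq_succ (x n) with h | ⟨j, hj⟩
  · rw [unitWeight_eq_zero h]; exact zero_le_one
  · have h : x n = 1 := by rw [hj]; fin_cases j; rfl
    rw [unitWeight, div_le_one (ha 1), h]
    simpa using pathWeight_le_of_eq_one (fun i => (ha i).le) h1 h

/-- At most one of two consecutive letters is 1, so at most one of the two weights is nonzero. -/
theorem Admissible.unitWeight_add_le_one {a : Fin 2 → ℝ} (ha : ∀ i, 0 < a i) (h1 : ∀ i, a i ≤ 1)
    {x : ℕ → Fin 2} (hx : Admissible x) (n : ℕ) :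
    unitWeight a x n + unitWeight a x (n + 1) ≤ 1 := by
  by_cases h : x n = 1
  · rw [unitWeight_eq_zero (hx n h), add_zero]
    exact unitWeight_le_one ha h1 x n
  · have h : x n = 0 := by omega
    rw [unitWeight_eq_zero h, zero_add]
    exact unitWeight_le_one ha h1 x _

/-- Transversality along a ray of parameters: two points of the ray at which two admissible paths
with different first letters have almost the same image are close to each other. -/
theorem ray_transversality {a : Fin 2 → ℝ} (ha : ∀ i, 0 < a i) (h1 : ∀ i, a i ≤ 1)
    {x y : ℕ → Fin 2} (hx : Admissible x) (hy : Admissible y) (hx0 : x 0 = 0) (hy0 : y 0 = 1)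
    {s t r : ℝ} (hs : 0 < s) (hst : s ≤ t) (ht : t ≤ 0.739)
    (hrs : |series (a 0 * s) (a 1 * s) x - series (a 0 * s) (a 1 * s) y| ≤ r)
    (hrt : |series (a 0 * t) (a 1 * t) x - series (a 0 * t) (a 1 * t) y| ≤ r) :
    0.01 * (t - s) ≤ 4 * r / (a 1 * s ^ 7) := by
  set e : ℕ → ℝ := fun n => unitWeight a y n - unitWeight a x n with he
  have hy1 : y 1 = 0 := hy 0 hy0
  have e0 : e 0 = 1 := by
    have := (ha 1).ne'
    simp [he, unitWeight, hx0, hy0, pathWeight, this]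
  have hbound : ∀ n, |e n| ≤ 1 := fun n => by
    rw [abs_le]
    have := unitWeight_le_one ha h1 x n
    have := unitWeight_le_one ha h1 y n
    have := unitWeight_nonneg ha x n
    have := unitWeight_nonneg ha y n
    constructor <;> simp only [he] <;> linarith
  have hpair : ∀ n, |e n + e (n + 1)| ≤ 1 := fun n => by
    rw [abs_le]
    have := hx.unitWeight_add_le_one ha h1 n
    have := hy.unitWeight_add_le_one ha h1 n
    have := unitWeight_nonneg ha x n
    have := unitWeight_nonneg ha y n
    have := unitWeight_nonneg ha x (n + 1)
    have := unitWeight_nonneg ha y (n + 1)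
    constructor <;> simp only [he] <;> linarith
  -- Dividing by a 1 * u, the first summand along y, normalises the constant term to 1.
  have hser : ∀ u : ℝ, 0 < u → u < 1 →
      ∑' n, e n * u ^ n = (series (a 0 * u) (a 1 * u) y - series (a 0 * u) (a 1 * u) x) /
        (a 1 * u) := by
    intro u hu0 hu1
    have m : ∀ i, a i * u ∈ Set.Ioo (0 : ℝ) 1 := fun i =>
      ⟨mul_pos (ha i) hu0, (mul_le_of_le_one_left hu0.le (h1 i)).trans_lt hu1⟩
    rw [series_eq_tsum, series_eq_tsum,
      ← (summable_pathWeight (m 0) (m 1) y).tsum_sub (summable_pathWeight (m 0) (m 1) x),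
      ← tsum_div_const]
    congr 1
    ext n
    have hv : (![a 0 * u, a 1 * u] : Fin 2 → ℝ) = fun i => a i * u := by
      ext i; fin_cases i <;> rfl
    rw [hv, pathWeight_smul, pathWeight_smul]
    have := (ha 1).ne'
    simp only [he, unitWeight]
    field_simp
    ring
  have hmain := transversality hbound e0 (abs_le.1 (hbound 1)).1 hpair hs hst ht
  have ht0 : 0 < t := hs.trans_le hst
  have hr : 0 ≤ r := (abs_nonneg _).trans hrs
  have a1 := ha 1
  have est : ∀ u : ℝ, s ≤ u → u ≤ 0.739 →
      |series (a 0 * u) (a 1 * u) x - series (a 0 * u) (a 1 * u) y| ≤ r →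
      |(1 + u) * (∑' n, e n * u ^ n) / u ^ 6| ≤ 2 * r / (a 1 * s ^ 7) := by
    intro u hu hu' hru
    have hu0 : 0 < u := hs.trans_le hu
    rw [hser u hu0 (by linarith), abs_div, abs_mul, abs_div, abs_sub_comm,
      abs_of_pos (show (0 : ℝ) < 1 + u by linarith), abs_of_pos (mul_pos a1 hu0),
      abs_of_pos (pow_pos hu0 6), mul_div_assoc', div_div,
      show a 1 * u * u ^ 6 = a 1 * u ^ 7 by ring]
    have : (1 + u) ≤ 2 := by linarith
    gcongr
  have b1 := (abs_le.1 (est s le_rfl (hst.trans ht) hrs)).2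
  have b2 := (abs_le.1 (est t hst ht hrt)).1
  calc _ ≤ _ := hmain
    _ ≤ 2 * r / (a 1 * s ^ 7) + 2 * r / (a 1 * s ^ 7) := by linarith
    _ = _ := by ring

/-- A compact square of parameters. -/
def paramSet (c : Fin 2 → ℝ) : Set (ℝ × ℝ) :=
  Set.Icc (c 0) 0.739 ×ˢ Set.Icc (c 1) 0.739

theorem measurableSet_paramSet (c : Fin 2 → ℝ) : MeasurableSet (paramSet c) :=
  measurableSet_Icc.prod measurableSet_Icc

theorem mem_Ioo_of_mem_paramSet {c : Fin 2 → ℝ} (hc : ∀ i, 0 < c i) {β : ℝ × ℝ}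
    (hβ : β ∈ paramSet c) : β.1 ∈ Set.Ioo (0 : ℝ) 1 ∧ β.2 ∈ Set.Ioo (0 : ℝ) 1 := by
  obtain ⟨⟨h1, h2⟩, h3, h4⟩ := hβ
  exact ⟨⟨(hc 0).trans_le h1, by linarith⟩, (hc 1).trans_le h3, by linarith⟩

/-- On a ray through the origin, the parameters at which two admissible paths with different first
letters have almost the same image form a set of small diameter. -/
theorem ray_diam {c : Fin 2 → ℝ} {γ : ℝ} (hγ : 0 < γ) (hγc : ∀ i, γ ≤ c i) {x y : ℕ → Fin 2}
    (hx : Admissible x) (hy : Admissible y) (hx0 : x 0 = 0) (hy0 : y 0 = 1) {u v : ℝ}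
    (huv : u ^ 2 + v ^ 2 = 1) {R R' r : ℝ} (hR : 0 < R) (hRR : R ≤ R')
    (hQ : (R * u, R * v) ∈ paramSet c) (hQ' : (R' * u, R' * v) ∈ paramSet c)
    (h : |series (R * u) (R * v) x - series (R * u) (R * v) y| ≤ r)
    (h' : |series (R' * u) (R' * v) x - series (R' * u) (R' * v) y| ≤ r) :
    R' - R ≤ 800 * r / γ ^ 8 := by
  obtain ⟨⟨q1, q2⟩, q3, q4⟩ := hQ
  obtain ⟨⟨q1', q2'⟩, q3', q4'⟩ := hQ'
  simp only at q1 q2 q3 q4 q1' q2' q3' q4'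
  have hγ0 := hγc 0
  have hγ1 := hγc 1
  have hu : 0 < u := pos_of_mul_pos_right (hγ.trans_le (hγ0.trans q1)) hR.le
  have hv : 0 < v := pos_of_mul_pos_right (hγ.trans_le (hγ1.trans q3)) hR.le
  -- Rescaling by the larger coordinate makes the direction a have maximum 1, so the ray parameter m
  -- * T is the larger coordinate of the point and stays below 0.739. As u ^ 2 + v ^ 2 = 1, m is at
  -- least 1/2, which costs a factor 2 in the final constant 800 = 100 * 4 * 2.
  set m := max u v with hm
  have hum : u ≤ m := le_max_left _ _
  have hvm : v ≤ m := le_max_right _ _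
  have hm0 : 0 < m := hu.trans_le hum
  have hmhalf : 1 / 2 ≤ m := by nlinarith
  have hm1 : m * R' ≤ 0.739 := by
    rcases max_choice u v with h | h <;> rw [hm, h] <;> linarith
  set a : Fin 2 → ℝ := ![u / m, v / m] with ha
  have ha0 : ∀ i, 0 < a i := by
    intro i; fin_cases i
    · exact div_pos hu hm0
    · exact div_pos hv hm0
  have ha1 : ∀ i, a i ≤ 1 := by
    intro i; fin_cases i
    · exact (div_le_one hm0).2 hum
    · exact (div_le_one hm0).2 hvm
  have e0 : ∀ T : ℝ, a 0 * (m * T) = T * u := fun T => by simp [ha]; field_simp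
  have e1 : ∀ T : ℝ, a 1 * (m * T) = T * v := fun T => by simp [ha]; field_simp
  have hr : 0 ≤ r := (abs_nonneg _).trans h
  have key := ray_transversality ha0 ha1 hx hy hx0 hy0 (s := m * R) (t := m * R') (r := r)
    (mul_pos hm0 hR) (by gcongr) hm1 (by rwa [e0, e1]) (by rwa [e0, e1])
  have hs : γ ≤ m * R := by nlinarith
  have hs1 : m * R ≤ 1 := by nlinarith
  have hsv : γ ≤ a 1 * (m * R) := by rw [e1]; linarith
  have hden : γ ^ 8 ≤ a 1 * (m * R) ^ 7 := by
    have p6 : γ ^ 6 ≤ (m * R) ^ 6 := by gcongr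
    have hγ1' : γ ≤ 1 := hs.trans hs1
    have hpos := hγ.le.trans hsv
    calc γ ^ 8 = γ * γ ^ 6 * γ := by ring
      _ ≤ γ * γ ^ 6 * 1 := by gcongr
      _ ≤ (a 1 * (m * R)) * (m * R) ^ 6 := by rw [mul_one]; gcongr
      _ = _ := by ring
  have h3 : 4 * r / (a 1 * (m * R) ^ 7) ≤ 4 * r / γ ^ 8 := by gcongr
  have h4 : 0.01 * (1 / 2 * (R' - R)) ≤ 0.01 * (m * R' - m * R) := by
    rw [← mul_sub]
    have : 0 ≤ R' - R := by linarith
    gcongr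
  have : 800 * r / γ ^ 8 = 200 * (4 * r / γ ^ 8) := by ring
  rw [this]
  linarith

/-- Cutting off the common prefix enlarges the tolerance by the inverse of its weight. Since c is
the lower corner of the square, the weight for c bounds the actual one from below, uniformly in the
parameter. -/
theorem ray_dist {c : Fin 2 → ℝ} {γ : ℝ} (hγ : 0 < γ) (hγc : ∀ i, γ ≤ c i) {x y : ℕ → Fin 2}
    (hx : Admissible x) (hy : Admissible y) {n : ℕ} (hxy : ∀ k < n, x k = y k) (hn : x n ≠ y n)
    {u v : ℝ} (huv : u ^ 2 + v ^ 2 = 1) {R R' r : ℝ} (hR : 0 < R) (hR' : 0 < R')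
    (hQ : (R * u, R * v) ∈ paramSet c) (hQ' : (R' * u, R' * v) ∈ paramSet c)
    (h : |series (R * u) (R * v) x - series (R * u) (R * v) y| ≤ r)
    (h' : |series (R' * u) (R' * v) x - series (R' * u) (R' * v) y| ≤ r) :
    |R' - R| ≤ 800 * (r / pathWeight c x n) / γ ^ 8 := by
  wlog hle : R ≤ R' generalizing R R'
  · rw [abs_sub_comm]
    exact this hR' hR hQ' hQ h' h (le_of_not_ge hle)
  rw [abs_of_nonneg (by linarith)]
  have hc : ∀ i, 0 < c i := fun i => hγ.trans_le (hγc i)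
  have shift : ∀ T : ℝ, (T * u, T * v) ∈ paramSet c →
      |series (T * u) (T * v) x - series (T * u) (T * v) y| ≤ r →
      |series (T * u) (T * v) (fun k => x (n + k)) -
        series (T * u) (T * v) (fun k => y (n + k))| ≤ r / pathWeight c x n := by
    intro T hT hrT
    have hm := mem_Ioo_of_mem_paramSet hc hT
    have hpos := pathWeight_pos hc x n
    have hb : pathWeight c x n ≤ pathWeight ![T * u, T * v] x n := by
      refine pathWeight_mono (fun i => (hc i).le) (fun i => ?_) x n
      fin_cases i
      · exact hT.1.1
      · exact hT.2.1
    rw [series_sub_series hm.1 hm.2 hxy, abs_mul, abs_of_pos (hpos.trans_le hb)] at hrT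
    rw [le_div_iff₀' hpos]
    exact (mul_le_mul_of_nonneg_right hb (abs_nonneg _)).trans hrT
  have s1 := shift R hQ h
  have s2 := shift R' hQ' h'
  rcases (show (x n = 0 ∧ y n = 1) ∨ (y n = 0 ∧ x n = 1) by omega) with ⟨h0, h1⟩ | ⟨h0, h1⟩
  · exact ray_diam hγ hγc (hx.shift n) (hy.shift n) h0 h1 huv hR hle hQ hQ' s1 s2
  · rw [abs_sub_comm] at s1 s2
    exact ray_diam hγ hγc (hy.shift n) (hx.shift n) h0 h1 huv hR hle hQ hQ' s1 s2

/-! ### From rays to area, with measurable dependence on the parameters -/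

/-- A measurable subset of the unit square all of whose slices along rays have diameter at most `d`
has area at most a multiple of `d`. -/
theorem volume_le_of_ray_dist {A : Set (ℝ × ℝ)} (hA : MeasurableSet A) {d : ℝ}
    (hA1 : ∀ β ∈ A, |β.1| ≤ 1 ∧ |β.2| ≤ 1)
    (hd : ∀ u v : ℝ, u ^ 2 + v ^ 2 = 1 → ∀ R R' : ℝ, 0 < R → 0 < R' →
      (R * u, R * v) ∈ A → (R' * u, R' * v) ∈ A → |R' - R| ≤ d) :
    volume A ≤ ENNReal.ofReal (4 * Real.pi * d) := by
  have hmeas : MeasurableSet (polarCoord.target ∩ polarCoord.symm ⁻¹' A) := by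
    refine polarCoord.open_target.measurableSet.inter ?_
    have : Measurable fun p : ℝ × ℝ => (p.1 * Real.cos p.2, p.1 * Real.sin p.2) := by fun_prop
    exact this hA
  rw [← lintegral_indicator_one hA, ← lintegral_comp_polarCoord_symm]
  -- In the unit square the squared radius is at most 2, so the Jacobian is at most 2.
  have step : ∫⁻ p in polarCoord.target,
      ENNReal.ofReal p.1 • A.indicator 1 (polarCoord.symm p) ≤
      ENNReal.ofReal 2 * volume (polarCoord.target ∩ polarCoord.symm ⁻¹' A) := by
    rw [← lintegral_indicator polarCoord.open_target.measurableSet,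
      ← lintegral_indicator_const hmeas]
    refine lintegral_mono fun p => ?_
    by_cases hp : p ∈ polarCoord.target
    · by_cases hpA : polarCoord.symm p ∈ A
      · have h2 : p ∈ polarCoord.target ∩ polarCoord.symm ⁻¹' A := ⟨hp, hpA⟩
        rw [Set.indicator_of_mem hp, Set.indicator_of_mem h2, Set.indicator_of_mem hpA]
        simp only [Pi.one_apply, smul_eq_mul, mul_one]
        refine ENNReal.ofReal_le_ofReal ?_
        have := hA1 _ hpA
        simp only [polarCoord_symm_apply] at this
        have e1 := sq_le_one_iff_abs_le_one _ |>.2 this.1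
        have e2 := sq_le_one_iff_abs_le_one _ |>.2 this.2
        have e3 : p.1 ^ 2 = (p.1 * Real.cos p.2) ^ 2 + (p.1 * Real.sin p.2) ^ 2 := by
          rw [mul_pow, mul_pow, ← mul_add, Real.cos_sq_add_sin_sq, mul_one]
        nlinarith
      · rw [Set.indicator_of_mem hp, Set.indicator_of_notMem hpA]
        simp
    · rw [Set.indicator_of_notMem hp]
      exact zero_le
  refine step.trans ?_
  rw [Measure.volume_eq_prod, Measure.prod_apply_symm hmeas]
  have slice : ∀ θ : ℝ, volume ((fun R : ℝ => (R, θ)) ⁻¹'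
      (polarCoord.target ∩ polarCoord.symm ⁻¹' A)) ≤
      (Set.Ioo (-Real.pi) Real.pi).indicator (fun _ => ENNReal.ofReal d) θ := by
    intro θ
    by_cases hθ : θ ∈ Set.Ioo (-Real.pi) Real.pi
    · rw [Set.indicator_of_mem hθ]
      refine (Real.volume_le_diam _).trans (Metric.ediam_le fun R hR R' hR' => ?_)
      rw [edist_comm, edist_dist, Real.dist_eq]
      exact ENNReal.ofReal_le_ofReal (hd (Real.cos θ) (Real.sin θ) (Real.cos_sq_add_sin_sq θ)
        R R' hR.1.1 hR'.1.1 hR.2 hR'.2)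
    · rw [Set.indicator_of_notMem hθ, nonpos_iff_eq_zero]
      convert measure_empty (μ := (volume : Measure ℝ))
      ext R
      simp only [Set.mem_preimage, Set.mem_inter_iff, Set.mem_empty_iff_false, iff_false]
      exact fun h => hθ h.1.2
  calc _ ≤ ENNReal.ofReal 2 * ∫⁻ θ : ℝ,
        (Set.Ioo (-Real.pi) Real.pi).indicator (fun _ => ENNReal.ofReal d) θ := by
        gcongr with θ; exact slice θ
    _ = ENNReal.ofReal (4 * Real.pi * d) := by
        have hpi := Real.pi_pos
        rw [lintegral_indicator_const measurableSet_Ioo, Real.volume_Ioo,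
          mul_comm (ENNReal.ofReal d), ← mul_assoc, ← ENNReal.ofReal_mul (by norm_num),
          ← ENNReal.ofReal_mul (by linarith)]
        congr 1
        ring

/-- The parameter clamped to `[c, 0.739]`. -/
noncomputable def clamp (c b : ℝ) : ℝ := min (max b c) 0.739

theorem measurable_clamp (c : ℝ) : Measurable (clamp c) := by unfold clamp; fun_prop

theorem clamp_of_mem {c b : ℝ} (h : b ∈ Set.Icc c 0.739) : clamp c b = b := by
  rw [clamp, max_eq_left h.1, min_eq_left h.2]

theorem clamp_mem {c : ℝ} (hc : 0 < c) (b : ℝ) : clamp c b ∈ Set.Ioo (0 : ℝ) 1 :=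
  ⟨lt_min (hc.trans_le (le_max_right _ _)) (by norm_num),
    (min_le_right _ _).trans_lt (by norm_num)⟩

/-- The random series at clamped parameters. -/
noncomputable def clampSeries (c : Fin 2 → ℝ) (β : ℝ × ℝ) (x : ℕ → Fin 2) : ℝ :=
  series (clamp (c 0) β.1) (clamp (c 1) β.2) x

theorem clampSeries_of_mem {c : Fin 2 → ℝ} {β : ℝ × ℝ} (hβ : β ∈ paramSet c) (x : ℕ → Fin 2) :
    clampSeries c β x = series β.1 β.2 x := by
  rw [clampSeries, clamp_of_mem hβ.1, clamp_of_mem hβ.2]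

/-- Clamping keeps the parameters inside (0, 1), so the partial sums converge at every point of the
product and joint measurability passes to the limit. -/
theorem measurable_clampSeries {c : Fin 2 → ℝ} (hc : ∀ i, 0 < c i) :
    Measurable fun q : (ℝ × ℝ) × (ℕ → Fin 2) => clampSeries c q.1 q.2 := by
  have hcl : ∀ j : Fin 2, Measurable fun q : (ℝ × ℝ) × (ℕ → Fin 2) =>
      (![clamp (c 0) q.1.1, clamp (c 1) q.1.2] : Fin 2 → ℝ) j := by
    intro j
    fin_cases j
    · exact (measurable_clamp _).comp (measurable_fst.comp measurable_fst)
    · exact (measurable_clamp _).comp (measurable_snd.comp measurable_fst)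
  have hletter : ∀ k, Measurable fun q : (ℝ × ℝ) × (ℕ → Fin 2) =>
      (![clamp (c 0) q.1.1, clamp (c 1) q.1.2] : Fin 2 → ℝ) (q.2 k) := by
    intro k
    have h := measurable_from_prod_countable_left
      (f := fun q : ((ℝ × ℝ) × (ℕ → Fin 2)) × Fin 2 =>
        (![clamp (c 0) q.1.1.1, clamp (c 1) q.1.1.2] : Fin 2 → ℝ) q.2) hcl
    exact h.comp (measurable_id.prodMk ((measurable_pi_apply k).comp measurable_snd))
  have hterm : ∀ n, Measurable fun q : (ℝ × ℝ) × (ℕ → Fin 2) =>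
      ((q.2 n : ℕ) : ℝ) * pathWeight ![clamp (c 0) q.1.1, clamp (c 1) q.1.2] q.2 (n + 1) := by
    intro n
    refine Measurable.mul ?_ ?_
    · exact (measurable_of_finite fun a : Fin 2 => ((a : ℕ) : ℝ)).comp
        ((measurable_pi_apply n).comp measurable_snd)
    · exact Finset.measurable_prod _ fun k _ => hletter k
  refine measurable_of_tendsto_metrizable
    (fun N => Finset.measurable_sum (Finset.range N) fun n _ => hterm n) ?_
  rw [tendsto_pi_nhds]
  intro q
  have := (summable_pathWeight (clamp_mem (hc 0) q.1.1)
    (clamp_mem (hc 1) q.1.2) q.2).hasSum.tendsto_sum_nat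
  rw [← series_eq_tsum] at this
  simpa [clampSeries] using this

/-- The transversality estimate on the parameter square. -/
theorem volume_near_le {c : Fin 2 → ℝ} {γ : ℝ} (hγ : 0 < γ) (hγc : ∀ i, γ ≤ c i)
    {x y : ℕ → Fin 2} (hx : Admissible x) (hy : Admissible y) {n : ℕ} (hxy : ∀ k < n, x k = y k)
    (hn : x n ≠ y n) (r : ℝ) :
    volume.restrict (paramSet c) {β | |clampSeries c β x - clampSeries c β y| ≤ r} ≤
      ENNReal.ofReal (4 * Real.pi * (800 * (r / pathWeight c x n) / γ ^ 8)) := by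
  have hc : ∀ i, 0 < c i := fun i => hγ.trans_le (hγc i)
  have hS : ∀ z : ℕ → Fin 2, Measurable fun β => clampSeries c β z := fun z =>
    (measurable_clampSeries hc).comp (measurable_id.prodMk measurable_const)
  have hm : MeasurableSet {β | |clampSeries c β x - clampSeries c β y| ≤ r} :=
    measurableSet_le (((hS x).sub (hS y)).abs) measurable_const
  rw [Measure.restrict_apply hm]
  refine volume_le_of_ray_dist (hm.inter (measurableSet_paramSet c)) ?_ ?_
  · intro β hβ
    have := mem_Ioo_of_mem_paramSet hc hβ.2
    rw [abs_of_pos this.1.1, abs_of_pos this.2.1]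
    exact ⟨this.1.2.le, this.2.2.le⟩
  · intro u v huv R R' hR hR' h h'
    have e := h.1
    have e' := h'.1
    simp only [Set.mem_ofPred_eq, clampSeries_of_mem h.2, clampSeries_of_mem h'.2] at e e'
    exact ray_dist hγ hγc hx hy hxy hn huv hR hR' h.2 h'.2 e e'

/-! ### Lower densities of measures on the line -/

theorem measurable_measure_closedBall (μ : Measure ℝ) [IsFiniteMeasure μ] (r : ℝ) :
    Measurable fun x => μ (Metric.closedBall x r) := by
  have : MeasurableSet {z : ℝ × ℝ | dist z.2 z.1 ≤ r} :=
    measurableSet_le (measurable_snd.dist measurable_fst) measurable_const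
  exact measurable_measure_prodMk_left this

theorem tendsto_one_div_nhdsWithin :
    Filter.Tendsto (fun j : ℕ => 1 / ((j : ℝ) + 1)) Filter.atTop (nhdsWithin 0 (Set.Ioi 0)) :=
  tendsto_nhdsWithin_iff.2 ⟨tendsto_one_div_add_atTop_nhds_zero_nat,
    Filter.Eventually.of_forall fun _ => Set.mem_Ioi.2 (by positivity)⟩

/-- The ratio of the measure of a closed ball to its length. -/
noncomputable def ballRatio (μ : Measure ℝ) (x : ℝ) (j : ℕ) : ENNReal :=
  μ (Metric.closedBall x (1 / ((j : ℝ) + 1))) / ENNReal.ofReal (2 * (1 / ((j : ℝ) + 1)))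

theorem measurable_ballRatio (μ : Measure ℝ) [IsFiniteMeasure μ] (j : ℕ) :
    Measurable fun x => ballRatio μ x j :=
  (measurable_measure_closedBall μ _).div_const _

/-- A finite measure whose lower density is finite almost everywhere is absolutely continuous. -/
theorem absolutelyContinuous_of_liminf_lt_top {μ : Measure ℝ} [IsFiniteMeasure μ] {s : ℝ}
    (hs : 0 < s)
    (h : ∀ᵐ x ∂μ, Filter.liminf (fun j => ballRatio μ x j ^ s) Filter.atTop < ⊤) :
    μ ≪ volume := by
  -- Differentiating Lebesgue measure with respect to μ gives a limit at μ-almost every point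
  -- without assuming absolute continuity. Where it vanishes, the inverse ratios tend to infinity,
  -- against the hypothesis.
  have hne : ∀ᵐ x ∂μ, (volume : Measure ℝ).rnDeriv μ x ≠ 0 := by
    filter_upwards [Besicovitch.ae_tendsto_rnDeriv (volume : Measure ℝ) μ, h] with x hx hlim h0
    rw [h0] at hx
    have h1 := hx.comp tendsto_one_div_nhdsWithin
    have h2 := ((continuous_inv (G := ENNReal)).tendsto 0).comp h1
    have h3 := ((ENNReal.continuous_rpow_const (y := s)).tendsto _).comp h2
    have h4 : Filter.liminf (fun j => ballRatio μ x j ^ s) Filter.atTop = ⊤ := by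
      rw [ENNReal.inv_zero, ENNReal.top_rpow_of_pos hs] at h3
      refine (Filter.Tendsto.congr (fun j => ?_) h3).liminf_eq
      simp only [Function.comp_apply, ballRatio]
      have hpos : (0 : ℝ) < 2 * (1 / ((j : ℝ) + 1)) := by positivity
      rw [Real.volume_closedBall, ENNReal.inv_div (Or.inr ENNReal.ofReal_ne_top)
        (Or.inr (ENNReal.ofReal_pos.2 hpos).ne')]
    exact hlim.ne h4
  refine Measure.AbsolutelyContinuous.mk fun A hA hA0 => ?_
  -- A function that is nonzero μ-almost everywhere has zero integral over A, so A is μ-null.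
  have h1 : ∫⁻ x in A, (volume : Measure ℝ).rnDeriv μ x ∂μ = 0 :=
    le_antisymm ((Measure.setLIntegral_rnDeriv_le A).trans hA0.le) zero_le
  rw [lintegral_eq_zero_iff (Measure.measurable_rnDeriv _ _)] at h1
  have h2 : ∀ᵐ x ∂μ.restrict A, False := by
    filter_upwards [h1, ae_restrict_of_ae hne] with x a b using b a
  rw [Filter.eventually_false_iff_eq_bot, ae_eq_bot, Measure.restrict_eq_zero] at h2
  exact h2

/-- A finite measure with integrable lower density has a square integrable density. -/
theorem hasL2Density_of_lintegral_liminf_lt_top {μ : Measure ℝ} [IsFiniteMeasure μ]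
    (h : ∫⁻ x, Filter.liminf (fun j => ballRatio μ x j) Filter.atTop ∂μ < ⊤) :
    HasL2Density μ := by
  have hm : Measurable fun x => Filter.liminf (fun j => ballRatio μ x j) Filter.atTop :=
    Measurable.liminf fun j => measurable_ballRatio μ j
  have hac : μ ≪ volume := by
    refine absolutelyContinuous_of_liminf_lt_top one_pos ?_
    simpa using ae_lt_top hm h.ne
  set f := μ.rnDeriv volume with hf
  have hfm : Measurable f := Measure.measurable_rnDeriv _ _
  have hd : volume.withDensity f = μ := Measure.withDensity_rnDeriv_eq _ _ hac
  have hlim : ∀ᵐ x ∂μ, f x = Filter.liminf (fun j => ballRatio μ x j) Filter.atTop := by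
    filter_upwards [hac.ae_le (Besicovitch.ae_tendsto_rnDeriv μ (volume : Measure ℝ))] with x hx
    have h1 := hx.comp tendsto_one_div_nhdsWithin
    refine (Filter.Tendsto.liminf_eq (Filter.Tendsto.congr (fun j => ?_) h1)).symm
    simp only [Function.comp_apply, ballRatio, Real.volume_closedBall]
  have hint : ∫⁻ x, f x * f x < ⊤ := by
    calc ∫⁻ x, f x * f x = ∫⁻ x, f x ∂(volume.withDensity f) :=
          (lintegral_withDensity_eq_lintegral_mul _ hfm hfm).symm
      _ < ⊤ := by rw [hd, lintegral_congr_ae hlim]; exact h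
  have htop : ∀ᵐ x, f x < ⊤ := Measure.rnDeriv_lt_top _ _
  refine ⟨fun x => (f x).toReal, fun x => ENNReal.toReal_nonneg, ?_, ?_⟩
  · refine ⟨hfm.ennreal_toReal.aestronglyMeasurable, ?_⟩
    rw [eLpNorm_lt_top_iff_lintegral_rpow_enorm_lt_top (by norm_num) (by norm_num)]
    refine lt_of_le_of_lt (lintegral_mono fun x => ?_) hint
    have : ‖(f x).toReal‖ₑ ≤ f x := by
      rw [Real.enorm_of_nonneg ENNReal.toReal_nonneg]
      exact ENNReal.ofReal_toReal_le
    simp only [ENNReal.toReal_ofNat, ENNReal.rpow_two, sq]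
    gcongr
  · rw [← hd]
    refine withDensity_congr_ae ?_
    filter_upwards [htop] with x hx using (ENNReal.ofReal_toReal hx.ne).symm

/-! ### Averaged energies of a family of projections -/

section Projection

variable {α Ω : Type*} [MeasurableSpace α] [MeasurableSpace Ω]

theorem measurable_measure_near {S : α → Ω → ℝ} (hS : Measurable (Function.uncurry S))
    (P : Measure Ω) [IsFiniteMeasure P] (r : ℝ) :
    Measurable fun z : α × Ω => P {w | |S z.1 z.2 - S z.1 w| ≤ r} := by
  have h1 : Measurable fun z : (α × Ω) × Ω => S z.1.1 z.1.2 := hS.comp measurable_fst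
  have h2 : Measurable fun z : (α × Ω) × Ω => S z.1.1 z.2 :=
    hS.comp ((measurable_fst.comp measurable_fst).prodMk measurable_snd)
  exact measurable_measure_prodMk_left (measurableSet_le (h1.sub h2).abs measurable_const)

/-- If the averaged energies of a measurable family of projections are bounded, then almost all
projections have a lower density in `L^s`. -/
theorem ae_lintegral_liminf_lt_top {S : α → Ω → ℝ} (hS : Measurable (Function.uncurry S))
    (P : Measure Ω) [IsFiniteMeasure P] (m : Measure α) {s : ℝ} (hs : 0 < s)
    {C : ENNReal} (hC : C ≠ ⊤)
    (h : ∀ r : ℝ, 0 < r → ∫⁻ q, ∫⁻ x, P {w | |S q x - S q w| ≤ r} ^ s ∂P ∂m ≤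
      C * ENNReal.ofReal (2 * r) ^ s) :
    ∀ᵐ q ∂m, ∫⁻ y, Filter.liminf (fun j => ballRatio (P.map (S q)) y j ^ s) Filter.atTop
      ∂(P.map (S q)) < ⊤ := by
  set r : ℕ → ℝ := fun j => 1 / ((j : ℝ) + 1) with hr
  have hr0 : ∀ j, 0 < r j := fun j => by positivity
  set F : ℕ → α × Ω → ENNReal := fun j z =>
    (P {w | |S z.1 z.2 - S z.1 w| ≤ r j} / ENNReal.ofReal (2 * r j)) ^ s with hF
  have hFm : ∀ j, Measurable (F j) := fun j =>
    ((measurable_measure_near hS P (r j)).div_const _).pow_const s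
  have hlim : Measurable fun z => Filter.liminf (fun j => F j z) Filter.atTop :=
    Measurable.liminf hFm
  have hbound : ∀ j, ∫⁻ q, ∫⁻ x, F j (q, x) ∂P ∂m ≤ C := by
    intro j
    have h2 : (0 : ℝ) < 2 * r j := by linarith [hr0 j]
    have hK : ENNReal.ofReal (2 * r j) ^ s ≠ 0 :=
      (ENNReal.rpow_pos (ENNReal.ofReal_pos.2 h2) ENNReal.ofReal_ne_top).ne'
    have hK' : ENNReal.ofReal (2 * r j) ^ s ≠ ⊤ :=
      ENNReal.rpow_ne_top_of_nonneg hs.le ENNReal.ofReal_ne_top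
    have e : ∀ z, F j z = (ENNReal.ofReal (2 * r j) ^ s)⁻¹ *
        P {w | |S z.1 z.2 - S z.1 w| ≤ r j} ^ s := by
      intro z
      simp only [hF]
      rw [ENNReal.div_rpow_of_nonneg _ _ hs.le, ENNReal.div_eq_inv_mul]
    simp_rw [e]
    have hmeas := (measurable_measure_near hS P (r j)).pow_const s
    calc _ = (ENNReal.ofReal (2 * r j) ^ s)⁻¹ *
          ∫⁻ q, ∫⁻ x, P {w | |S q x - S q w| ≤ r j} ^ s ∂P ∂m := by
          rw [← lintegral_const_mul _ hmeas.lintegral_prod_right']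
          congr 1
          ext q
          exact lintegral_const_mul _ (hmeas.comp measurable_prodMk_left)
      _ ≤ (ENNReal.ofReal (2 * r j) ^ s)⁻¹ * (C * ENNReal.ofReal (2 * r j) ^ s) := by
          gcongr; exact h _ (hr0 j)
      _ = C := by
          rw [mul_comm C, ← mul_assoc, ENNReal.inv_mul_cancel hK hK', one_mul]
  -- Fatou is applied twice, first over the path and then over the parameter.
  have hfatou : ∫⁻ q, ∫⁻ x, Filter.liminf (fun j => F j (q, x)) Filter.atTop ∂P ∂m ≤ C := by
    calc _ ≤ ∫⁻ q, Filter.liminf (fun j => ∫⁻ x, F j (q, x) ∂P) Filter.atTop ∂m :=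
          lintegral_mono fun q => lintegral_liminf_le fun j => (hFm j).comp measurable_prodMk_left
      _ ≤ Filter.liminf (fun j => ∫⁻ q, ∫⁻ x, F j (q, x) ∂P ∂m) Filter.atTop :=
          lintegral_liminf_le fun j => (hFm j).lintegral_prod_right'
      _ ≤ Filter.liminf (fun _ : ℕ => C) Filter.atTop :=
          Filter.liminf_le_liminf (Filter.Eventually.of_forall hbound)
      _ = C := Filter.liminf_const _
  filter_upwards [ae_lt_top hlim.lintegral_prod_right' (hfatou.trans_lt hC.lt_top).ne] with q hq
  refine lt_of_le_of_lt (lintegral_map_le _ _) (lt_of_le_of_lt (le_of_eq ?_) hq)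
  have hSq : Measurable (S q) := hS.comp measurable_prodMk_left
  refine lintegral_congr fun x => ?_
  congr 1
  ext j
  simp only [hF, ballRatio]
  rw [Measure.map_apply hSq Metric.isClosed_closedBall.measurableSet]
  congr 3
  ext w
  simp [Metric.mem_closedBall, Real.dist_eq, abs_sub_comm, hr]

theorem rpow_tsum_le_tsum_rpow (f : ℕ → ENNReal) {s : ℝ} (hs : 0 < s) (hs1 : s ≤ 1) :
    (∑' n, f n) ^ s ≤ ∑' n, f n ^ s := by
  have hfin : ∀ N : ℕ, (∑ n ∈ Finset.range N, f n) ^ s ≤ ∑ n ∈ Finset.range N, f n ^ s := by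
    intro N
    induction N with
    | zero => simp [hs]
    | succ N ih =>
      rw [Finset.sum_range_succ, Finset.sum_range_succ]
      exact (ENNReal.rpow_add_le_add_rpow _ _ hs.le hs1).trans (by gcongr)
  have h1 := ((ENNReal.continuous_rpow_const (y := s)).tendsto _).comp
    (ENNReal.tendsto_nat_tsum f)
  exact le_of_tendsto_of_tendsto' h1 (ENNReal.tendsto_nat_tsum fun n => f n ^ s) hfin

/-- If a exceeds A, then a ^ (s - 1) ≤ A ^ (s - 1) because s - 1 ≤ 0. This affine bound replaces the
tangent line in Jensen's inequality. -/
theorem rpow_le_add_rpow_sub_one_mul {A : ENNReal} (hA : A ≠ 0) (hA' : A ≠ ⊤) (a : ENNReal)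
    {s : ℝ} (hs : 0 < s) (hs1 : s ≤ 1) : a ^ s ≤ A ^ s + A ^ (s - 1) * a := by
  rcases le_total a A with h | h
  · exact (ENNReal.rpow_le_rpow h hs.le).trans le_self_add
  · refine le_trans ?_ le_add_self
    by_cases ht : a = ⊤
    · rw [ht, ENNReal.mul_top]
      · exact le_top
      · exact (ENNReal.rpow_pos (pos_iff_ne_zero.2 hA) hA').ne'
    · have h0 : a ≠ 0 := (lt_of_lt_of_le (pos_iff_ne_zero.2 hA) h).ne'
      calc a ^ s = a ^ (s - 1) * a ^ (1 : ℝ) := by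
            rw [← ENNReal.rpow_add _ _ h0 ht]; congr 1; ring
        _ ≤ A ^ (s - 1) * a := by
            rw [ENNReal.rpow_one]
            gcongr ?_ * _
            rw [show s - 1 = -(1 - s) by ring, ENNReal.rpow_neg, ENNReal.rpow_neg]
            exact ENNReal.inv_le_inv.2 (ENNReal.rpow_le_rpow h (by linarith))

/-- Jensen's inequality for concave powers, with a crude constant. -/
theorem lintegral_rpow_le {m : Measure α} {f : α → ENNReal} {A : ENNReal}
    (hA' : A ≠ ⊤) (hf : Measurable f) (h : ∫⁻ q, f q ∂m ≤ A) {s : ℝ} (hs : 0 < s)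
    (hs1 : s ≤ 1) : ∫⁻ q, f q ^ s ∂m ≤ A ^ s * (m Set.univ + 1) := by
  by_cases hA : A = 0
  · rw [hA, nonpos_iff_eq_zero, lintegral_eq_zero_iff hf] at h
    have : ∫⁻ q, f q ^ s ∂m = 0 := by
      rw [lintegral_eq_zero_iff (hf.pow_const s)]
      filter_upwards [h] with q hq
      simp [hq, hs]
    rw [this]
    exact zero_le
  calc _ ≤ ∫⁻ q, (A ^ s + A ^ (s - 1) * f q) ∂m :=
        lintegral_mono fun q => rpow_le_add_rpow_sub_one_mul hA hA' (f q) hs hs1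
    _ = A ^ s * m Set.univ + A ^ (s - 1) * ∫⁻ q, f q ∂m := by
        rw [lintegral_add_left measurable_const, lintegral_const, lintegral_const_mul _ hf]
    _ ≤ A ^ s * m Set.univ + A ^ (s - 1) * A ^ (1 : ℝ) := by rw [ENNReal.rpow_one]; gcongr
    _ = A ^ s * (m Set.univ + 1) := by
        rw [← ENNReal.rpow_add _ _ hA hA', mul_add, mul_one]; congr 2; ring

end Projection

/-! ### The Markov property and cylinder probabilities -/

theorem weightMeasure_singleton (w : Fin 2 → ℝ) (j : Fin 2) :
    weightMeasure w {j} = ENNReal.ofReal (w j) := by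
  fin_cases j <;> simp [weightMeasure, Fin.sum_univ_two]

theorem isProbabilityMeasure_initial (p : Set.Ioo (0 : ℝ) 1) :
    IsProbabilityMeasure (weightMeasure (initialVector p)) := by
  have hp := p.2
  have h2 : (0 : ℝ) < 2 - p := by linarith [hp.2]
  apply isProbabilityMeasure_weightMeasure
  · simpa [initialVector] using h2.le
  · simpa [initialVector] using div_nonneg (by linarith [hp.2]) h2.le
  · simp only [initialVector, Matrix.cons_val_zero, Matrix.cons_val_one]
    field_simp
    ring

/-- A functional of the path depending only on the coordinates up to `n`. -/
def DependsUpTo (n : ℕ) (F : (ℕ → Fin 2) → ENNReal) : Prop :=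
  ∀ x y, (∀ k ≤ n, x k = y k) → F x = F y

theorem DependsUpTo.exists_factor {n : ℕ} {F : (ℕ → Fin 2) → ENNReal} (hF : DependsUpTo n F) :
    ∃ G : ((_ : Finset.Iic n) → Fin 2) → ENNReal, ∀ x, F x = G (Preorder.frestrictLe n x) := by
  refine ⟨fun u => F fun k => if h : k ≤ n then u ⟨k, Finset.mem_Iic.2 h⟩ else 0, fun x => ?_⟩
  refine hF _ _ fun k hk => ?_
  simp [hk, Preorder.frestrictLe, Finset.restrict]

theorem DependsUpTo.measurable {n : ℕ} {F : (ℕ → Fin 2) → ENNReal} (hF : DependsUpTo n F) :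
    Measurable F := by
  obtain ⟨G, hG⟩ := hF.exists_factor
  have : F = G ∘ Preorder.frestrictLe (π := fun _ => Fin 2) n := funext hG
  rw [this]
  exact (measurable_of_finite G).comp (Preorder.measurable_frestrictLe n)

/-- The Markov property. -/
theorem lintegral_mul_indicator_next (p : Set.Ioo (0 : ℝ) 1) {n : ℕ}
    {F : (ℕ → Fin 2) → ENNReal} (hF : DependsUpTo n F) (j : Fin 2) :
    ∫⁻ x, F x * (if x (n + 1) = j then 1 else 0) ∂(chainLaw p) =
      ∫⁻ x, F x * ENNReal.ofReal (transitionMatrix p (x n) j) ∂(chainLaw p) := by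
  obtain ⟨G, hG⟩ := hF.exists_factor
  have := isProbabilityMeasure_initial p
  have hmap := Kernel.map_frestrictLe_trajMeasure_compProd_eq_map_trajMeasure
    (X := fun _ => Fin 2) (μ₀ := weightMeasure (initialVector p)) (κ := stepKernel p) (a := n)
  have hm1 : Measurable (Preorder.frestrictLe (π := fun _ : ℕ => Fin 2) n) :=
    Preorder.measurable_frestrictLe n
  have hm2 : Measurable fun x : ℕ → Fin 2 =>
      (Preorder.frestrictLe (π := fun _ : ℕ => Fin 2) n x, x (n + 1)) :=
    hm1.prodMk (measurable_pi_apply _)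
  set g : ((_ : Finset.Iic n) → Fin 2) × Fin 2 → ENNReal :=
    fun z => G z.1 * (if z.2 = j then 1 else 0) with hg
  have hgm : Measurable g := measurable_of_finite g
  calc _ = ∫⁻ x, g (Preorder.frestrictLe (π := fun _ : ℕ => Fin 2) n x, x (n + 1))
        ∂(chainLaw p) := by simp only [hg, hG]
    _ = ∫⁻ z, g z ∂((chainLaw p).map fun x =>
        (Preorder.frestrictLe (π := fun _ : ℕ => Fin 2) n x, x (n + 1))) :=
        (lintegral_map hgm hm2).symm
    _ = ∫⁻ z, g z ∂((chainLaw p).map (Preorder.frestrictLe (π := fun _ : ℕ => Fin 2) n) ⊗ₘ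
        stepKernel p n) := by
        unfold chainLaw
        rw [hmap]
    _ = ∫⁻ u, ∫⁻ b, g (u, b) ∂(stepKernel p n u)
        ∂((chainLaw p).map (Preorder.frestrictLe (π := fun _ : ℕ => Fin 2) n)) :=
        Measure.lintegral_compProd hgm
    _ = ∫⁻ x, ∫⁻ b, g (Preorder.frestrictLe (π := fun _ : ℕ => Fin 2) n x, b)
        ∂(stepKernel p n (Preorder.frestrictLe (π := fun _ : ℕ => Fin 2) n x)) ∂(chainLaw p) :=
        lintegral_map (measurable_of_finite _) hm1
    _ = _ := by
        refine lintegral_congr fun x => ?_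
        simp only [hg]
        rw [lintegral_const_mul _ (measurable_of_finite _), ← hG]
        congr 1
        have : (fun b : Fin 2 => if b = j then (1 : ENNReal) else 0) =
            Set.indicator {j} 1 := by
          ext b; simp [Set.indicator_apply]
        rw [this, lintegral_indicator_one (measurableSet_singleton j)]
        exact weightMeasure_singleton _ j

theorem ae_admissible (p : Set.Ioo (0 : ℝ) 1) : ∀ᵐ x ∂(chainLaw p), Admissible x := by
  rw [show (∀ᵐ x ∂(chainLaw p), Admissible x) ↔
    ∀ᵐ x ∂(chainLaw p), ∀ n, x n = 1 → x (n + 1) = 0 from Iff.rfl, ae_all_iff]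
  intro n
  have hF : DependsUpTo n fun x => if x n = 1 then 1 else 0 := fun x y h => by
    simp only [h n le_rfl]
  have h := lintegral_mul_indicator_next p hF 1
  have h0 : ∫⁻ x, (if x n = 1 then (1 : ENNReal) else 0) *
      ENNReal.ofReal (transitionMatrix p (x n) 1) ∂(chainLaw p) = 0 := by
    rw [← lintegral_zero (μ := chainLaw p)]
    refine lintegral_congr fun x => ?_
    by_cases hx : x n = 1
    · simp [hx, transitionMatrix]
    · simp [hx]
  have hm : Measurable fun x : ℕ → Fin 2 =>
      (if x n = 1 then (1 : ENNReal) else 0) * (if x (n + 1) = 1 then 1 else 0) :=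
    hF.measurable.mul ((measurable_of_finite fun a : Fin 2 =>
      if a = 1 then (1 : ENNReal) else 0).comp (measurable_pi_apply (n + 1)))
  rw [h0, lintegral_eq_zero_iff hm] at h
  filter_upwards [h] with x hx h1
  by_contra h2
  have h3 : x (n + 1) = 1 := by omega
  simp [h1, h3] at hx

/-- The cylinder of the paths agreeing with `x` in the first `n` letters. -/
def cylinder (x : ℕ → Fin 2) (n : ℕ) : Set (ℕ → Fin 2) := {y | ∀ k < n, x k = y k}

theorem measurableSet_cylinder (x : ℕ → Fin 2) (n : ℕ) : MeasurableSet (cylinder x n) := by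
  have : cylinder x n = ⋂ k, ⋂ (_ : k < n), {y | x k = y k} := by
    ext y; simp [cylinder]
  rw [this]
  exact MeasurableSet.iInter fun k => MeasurableSet.iInter fun _ =>
    measurableSet_eq_fun measurable_const (measurable_pi_apply k)

theorem cylinder_congr {x y : ℕ → Fin 2} {n : ℕ} (h : ∀ k < n, x k = y k) :
    cylinder x n = cylinder y n := by
  ext z
  exact forall₂_congr fun k hk => by rw [h k hk]

/-- The Markov property applied to the indicator of the shorter cylinder. The lengths start at 1
because the first letter is governed by the initial vector, not by a transition. -/
theorem chainLaw_cylinder_succ (p : Set.Ioo (0 : ℝ) 1) (x : ℕ → Fin 2) (n : ℕ) :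
    chainLaw p (cylinder x (n + 2)) = chainLaw p (cylinder x (n + 1)) *
      ENNReal.ofReal (transitionMatrix p (x n) (x (n + 1))) := by
  classical
  have hF : DependsUpTo n ((cylinder x (n + 1)).indicator 1) := fun y z h => by
    have : y ∈ cylinder x (n + 1) ↔ z ∈ cylinder x (n + 1) :=
      forall₂_congr fun k hk => by rw [h k (by omega)]
    simp [Set.indicator_apply, this]
  have h := lintegral_mul_indicator_next p hF (x (n + 1))
  rw [← lintegral_indicator_one (measurableSet_cylinder x (n + 2)),
    ← lintegral_indicator_one (measurableSet_cylinder x (n + 1)),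
    ← lintegral_mul_const _ hF.measurable]
  refine (lintegral_congr fun y => ?_).trans (h.trans (lintegral_congr fun y => ?_))
  · have : y ∈ cylinder x (n + 2) ↔ y ∈ cylinder x (n + 1) ∧ y (n + 1) = x (n + 1) := by
      constructor
      · exact fun hy => ⟨fun k hk => hy k (by omega), (hy (n + 1) (by omega)).symm⟩
      · rintro ⟨hy, hy'⟩ k hk
        rcases Nat.lt_succ_iff_lt_or_eq.1 hk with h | h
        · exact hy k h
        · rw [h]; exact hy'.symm
    by_cases h1 : y ∈ cylinder x (n + 1) <;> by_cases h2 : y (n + 1) = x (n + 1) <;>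
      simp [this, h1, h2]
  · by_cases h1 : y ∈ cylinder x (n + 1)
    · rw [h1 n (by omega)]
    · simp [h1]

/-! ### Moments of the mass ratio -/

/-- The ratio of the probability of a cylinder and the contraction ratio along it. -/
noncomputable def massRatio (p : Set.Ioo (0 : ℝ) 1) (c : Fin 2 → ℝ) (x : ℕ → Fin 2) (n : ℕ) :
    ENNReal :=
  chainLaw p (cylinder x n) / ENNReal.ofReal (pathWeight c x n)

theorem massRatio_zero (p : Set.Ioo (0 : ℝ) 1) (c : Fin 2 → ℝ) (x : ℕ → Fin 2) :
    massRatio p c x 0 = 1 := by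
  have : cylinder x 0 = Set.univ := by ext; simp [cylinder]
  simp [massRatio, this, pathWeight]

theorem massRatio_succ (p : Set.Ioo (0 : ℝ) 1) {c : Fin 2 → ℝ} (hc : ∀ i, 0 < c i)
    (x : ℕ → Fin 2) (n : ℕ) : massRatio p c x (n + 2) = massRatio p c x (n + 1) *
      ENNReal.ofReal (transitionMatrix p (x n) (x (n + 1)) / c (x (n + 1))) := by
  have h1 := pathWeight_pos hc x (n + 1)
  simp only [massRatio, chainLaw_cylinder_succ]
  rw [pathWeight_succ c x (n + 1), ENNReal.ofReal_mul h1.le, ENNReal.ofReal_div_of_pos (hc _),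
    div_eq_mul_inv, div_eq_mul_inv, div_eq_mul_inv,
    ENNReal.mul_inv (Or.inr ENNReal.ofReal_ne_top) (Or.inl ENNReal.ofReal_ne_top)]
  ring

theorem dependsUpTo_massRatio (p : Set.Ioo (0 : ℝ) 1) (c : Fin 2 → ℝ) (n : ℕ) :
    DependsUpTo n fun x => massRatio p c x (n + 1) := fun x y h => by
  have h' : ∀ k < n + 1, x k = y k := fun k hk => h k (by omega)
  simp only [massRatio, cylinder_congr h', pathWeight_congr c h']

theorem measurable_massRatio (p : Set.Ioo (0 : ℝ) 1) (c : Fin 2 → ℝ) (n : ℕ) :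
    Measurable fun x => massRatio p c x n := by
  cases n with
  | zero => simpa only [massRatio_zero] using measurable_const
  | succ n => exact (dependsUpTo_massRatio p c n).measurable

/-- The moment of the mass ratio over the paths whose letter `n` is `j`. -/
noncomputable def massMoment (p : Set.Ioo (0 : ℝ) 1) (c : Fin 2 → ℝ) (s : ℝ) (n : ℕ)
    (j : Fin 2) : ENNReal :=
  ∫⁻ x, massRatio p c x (n + 1) ^ s * (if x n = j then 1 else 0) ∂(chainLaw p)

theorem dependsUpTo_moment (p : Set.Ioo (0 : ℝ) 1) (c : Fin 2 → ℝ) (s : ℝ) (n : ℕ)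
    (j : Fin 2) : DependsUpTo n fun x =>
      massRatio p c x (n + 1) ^ s * (if x n = j then 1 else 0) := fun x y h => by
  simp only [dependsUpTo_massRatio p c n x y h, h n le_rfl]

/-- One new letter multiplies the ratio by P i j / c j, and integrating that letter out contributes
one more factor P i j; this is where the exponent 1 + s arises. -/
theorem massMoment_succ (p : Set.Ioo (0 : ℝ) 1) {c : Fin 2 → ℝ} (hc : ∀ i, 0 < c i) {s : ℝ}
    (hs : 0 < s) (n : ℕ) (j : Fin 2) : massMoment p c s (n + 1) j =
      ∑ i : Fin 2, massMoment p c s n i *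
        (ENNReal.ofReal (transitionMatrix p i j / c j) ^ s *
          ENNReal.ofReal (transitionMatrix p i j)) := by
  have hF : DependsUpTo n fun x => massRatio p c x (n + 1) ^ s *
      ENNReal.ofReal (transitionMatrix p (x n) j / c j) ^ s := fun x y h => by
    simp only [dependsUpTo_massRatio p c n x y h, h n le_rfl]
  have hM := lintegral_mul_indicator_next p hF j
  simp only [massMoment]
  calc _ = ∫⁻ x, massRatio p c x (n + 1) ^ s *
        ENNReal.ofReal (transitionMatrix p (x n) j / c j) ^ s *
        (if x (n + 1) = j then 1 else 0) ∂(chainLaw p) := by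
        refine lintegral_congr fun x => ?_
        by_cases hx : x (n + 1) = j
        · rw [massRatio_succ p hc, hx, ENNReal.mul_rpow_of_nonneg _ _ hs.le]
        · simp [hx]
    _ = ∫⁻ x, ∑ i : Fin 2, massRatio p c x (n + 1) ^ s * (if x n = i then 1 else 0) *
        (ENNReal.ofReal (transitionMatrix p i j / c j) ^ s *
          ENNReal.ofReal (transitionMatrix p i j)) ∂(chainLaw p) := by
        rw [hM]
        refine lintegral_congr fun x => ?_
        rw [Finset.sum_eq_single (x n)]
        · simp [mul_assoc]
        · intro i _ hi
          simp [hi.symm]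
        · simp
    _ = _ := by
        rw [lintegral_finsetSum _ fun i _ =>
          (dependsUpTo_moment p c s n i).measurable.mul_const _]
        exact Finset.sum_congr rfl fun i _ =>
          lintegral_mul_const _ (dependsUpTo_moment p c s n i).measurable

theorem lintegral_massRatio_succ (p : Set.Ioo (0 : ℝ) 1) (c : Fin 2 → ℝ) (s : ℝ) (n : ℕ) :
    ∫⁻ x, massRatio p c x (n + 1) ^ s ∂(chainLaw p) =
      massMoment p c s n 0 + massMoment p c s n 1 := by
  simp only [massMoment]
  rw [← lintegral_add_left (dependsUpTo_moment p c s n 0).measurable]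
  refine lintegral_congr fun x => ?_
  rcases (show x n = 0 ∨ x n = 1 by omega) with h | h <;> simp [h]

/-- The characteristic sum of the weighted transition matrix; the matrix with entries
`P i j ^ (1 + s) / c j ^ s` has spectral radius below one if and only if it is below one. -/
noncomputable def charSum (p : ℝ) (c : Fin 2 → ℝ) (s : ℝ) : ℝ :=
  p * (p / c 0) ^ s + (1 - p) * ((1 - p) / (c 0 * c 1)) ^ s

/-- The two moments obey a linear recursion, and a suitable positive combination of them contracts
geometrically. -/
theorem tsum_massRatio_lt_top (p : Set.Ioo (0 : ℝ) 1) {c : Fin 2 → ℝ} (hc : ∀ i, 0 < c i)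
    (hc1 : ∀ i, c i ≤ 1) {s : ℝ} (hs : 0 < s) (h : charSum p c s < 1) :
    ∑' n, ∫⁻ x, massRatio p c x n ^ s ∂(chainLaw p) < ⊤ := by
  have hp := p.2
  obtain ⟨p, hp'⟩ := p
  simp only at hp h
  have hp0 : 0 < p := hp.1
  have hq0 : 0 < 1 - p := by linarith [hp.2]
  have c0 := hc 0
  have c1 := hc 1
  set T0 := p * (p / c 0) ^ s with hT0
  set T1 := (1 - p) * ((1 - p) / c 1) ^ s with hT1
  set w := (1 / c 0) ^ s with hw
  have hw0 : 0 < w := by positivity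
  have hT0' : 0 < T0 := by positivity
  have hT1' : 0 < T1 := by positivity
  have hsplit : charSum p c s = T0 + w * T1 := by
    rw [charSum, hT0, hT1, hw, mul_left_comm w,
      ← Real.mul_rpow (by positivity) (by positivity)]
    congr 3
    field_simp
  have hw1 : 1 ≤ w := Real.one_le_rpow (by rw [one_le_div c0]; exact hc1 0) hs.le
  -- The weight κ = w would contract the first coordinate but only preserve the second. Spending
  -- part of the gap below 1 on ε makes both factors smaller than 1.
  obtain ⟨ε, hε0, hε⟩ : ∃ ε : ℝ, 0 < ε ∧ T0 + (1 + ε) * w * T1 < 1 := by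
    refine ⟨(1 - (T0 + w * T1)) / (2 * (w * T1)), ?_, ?_⟩
    · have : 0 < 1 - (T0 + w * T1) := by linarith
      positivity
    · have e : T0 + (1 + (1 - (T0 + w * T1)) / (2 * (w * T1))) * w * T1 =
          T0 + w * T1 + (1 - (T0 + w * T1)) / 2 := by field_simp; ring
      rw [e]; linarith
  set κ := (1 + ε) * w with hκ
  set ρ := max (T0 + κ * T1) (1 / (1 + ε)) with hρ
  have hρ1 : ρ < 1 := max_lt hε ((div_lt_one (by linarith)).2 (by linarith))
  have hρ0 : 0 < ρ := lt_max_of_lt_right (by positivity)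
  have hκ1 : 1 ≤ κ := by nlinarith
  have hκ0 : 0 < κ := by linarith
  have hwρ : w ≤ ρ * κ := by
    calc w = 1 / (1 + ε) * κ := by rw [hκ]; field_simp
      _ ≤ _ := by gcongr; exact le_max_right _ _
  set P : Set.Ioo (0 : ℝ) 1 := ⟨p, hp'⟩ with hP
  set Z := massMoment P c s with hZ
  have r0 : ∀ n, Z (n + 1) 0 = Z n 0 * ENNReal.ofReal T0 + Z n 1 * ENNReal.ofReal w := by
    intro n
    rw [hZ, massMoment_succ P hc hs, Fin.sum_univ_two]
    simp only [transitionMatrix, Matrix.of_apply, Matrix.cons_val_zero, Matrix.cons_val_one, hP]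
    rw [ENNReal.ofReal_rpow_of_pos (by positivity), ENNReal.ofReal_rpow_of_pos (by positivity),
      ← ENNReal.ofReal_mul (by positivity), mul_comm _ p, ENNReal.ofReal_one, mul_one]
  have r1 : ∀ n, Z (n + 1) 1 = Z n 0 * ENNReal.ofReal T1 := by
    intro n
    rw [hZ, massMoment_succ P hc hs, Fin.sum_univ_two]
    simp only [transitionMatrix, Matrix.of_apply, Matrix.cons_val_zero, Matrix.cons_val_one, hP]
    rw [ENNReal.ofReal_rpow_of_pos (by positivity), ← ENNReal.ofReal_mul (by positivity),
      mul_comm _ (1 - p), ← hT1]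
    simp
  set L : ℕ → ENNReal := fun n => Z n 0 + ENNReal.ofReal κ * Z n 1 with hL
  have hstep : ∀ n, L (n + 1) ≤ ENNReal.ofReal ρ * L n := by
    intro n
    calc L (n + 1) = Z n 0 * ENNReal.ofReal (T0 + κ * T1) + Z n 1 * ENNReal.ofReal w := by
          simp only [hL, r0, r1]
          rw [ENNReal.ofReal_add (by positivity) (by positivity), ENNReal.ofReal_mul hκ0.le]
          ring
      _ ≤ Z n 0 * ENNReal.ofReal ρ + Z n 1 * ENNReal.ofReal (ρ * κ) := by
          gcongr
          exact le_max_left _ _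
      _ = _ := by
          simp only [hL]
          rw [ENNReal.ofReal_mul hρ0.le]
          ring
  have hgeo : ∀ n, L n ≤ ENNReal.ofReal ρ ^ n * L 0 := by
    intro n
    induction n with
    | zero => simp
    | succ n ih =>
      calc L (n + 1) ≤ ENNReal.ofReal ρ * (ENNReal.ofReal ρ ^ n * L 0) :=
            (hstep n).trans (by gcongr)
        _ = _ := by ring
  have hL0 : L 0 < ⊤ := by
    have hZ0 : ∀ j, Z 0 j < ⊤ := by
      intro j
      set γ := min (c 0) (c 1) with hγ
      have hγ0 : 0 < γ := lt_min c0 c1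
      have hb : ∀ x, massRatio P c x (0 + 1) ^ s * (if x 0 = j then 1 else 0) ≤
          (ENNReal.ofReal γ)⁻¹ ^ s := by
        intro x
        have hx : γ ≤ pathWeight c x (0 + 1) := by
          simp only [pathWeight, zero_add, Finset.prod_range_one]
          rcases (show x 0 = 0 ∨ x 0 = 1 by omega) with h | h <;> rw [h]
          · exact min_le_left _ _
          · exact min_le_right _ _
        calc massRatio P c x (0 + 1) ^ s * (if x 0 = j then 1 else 0)
            ≤ massRatio P c x (0 + 1) ^ s * 1 := by gcongr; split_ifs <;> simp
          _ ≤ _ := by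
            rw [mul_one, massRatio, div_eq_mul_inv]
            refine ENNReal.rpow_le_rpow ?_ hs.le
            calc _ ≤ 1 * (ENNReal.ofReal γ)⁻¹ :=
                  mul_le_mul' prob_le_one (ENNReal.inv_le_inv.2 (ENNReal.ofReal_le_ofReal hx))
              _ = _ := one_mul _
      refine (lintegral_mono hb).trans_lt ?_
      rw [lintegral_const, measure_univ, mul_one]
      exact ENNReal.rpow_lt_top_of_nonneg hs.le
        (ENNReal.inv_ne_top.2 (ENNReal.ofReal_pos.2 hγ0).ne')
    exact ENNReal.add_lt_top.2 ⟨hZ0 0, ENNReal.mul_lt_top ENNReal.ofReal_lt_top (hZ0 1)⟩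
  have hterm : ∀ n, ∫⁻ x, massRatio P c x (n + 1) ^ s ∂(chainLaw P) ≤
      ENNReal.ofReal ρ ^ n * L 0 := by
    intro n
    refine le_trans ?_ (hgeo n)
    rw [lintegral_massRatio_succ]
    have : (1 : ENNReal) ≤ ENNReal.ofReal κ := by simpa using hκ1
    calc Z n 0 + Z n 1 = Z n 0 + 1 * Z n 1 := by rw [one_mul]
      _ ≤ _ := by simp only [hL]; gcongr
  rw [tsum_eq_zero_add' ENNReal.summable]
  refine ENNReal.add_lt_top.2 ⟨?_, ?_⟩
  · simp [massRatio_zero]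
  · refine (ENNReal.tsum_le_tsum hterm).trans_lt ?_
    rw [ENNReal.tsum_mul_right, ENNReal.tsum_geometric]
    refine ENNReal.mul_lt_top ?_ hL0
    rw [ENNReal.inv_lt_top, tsub_pos_iff_lt]
    simpa using hρ1

/-! ### The energy estimate over a parameter square -/

theorem volume_paramSet_lt_top (c : Fin 2 → ℝ) : volume (paramSet c) < ⊤ :=
  (isCompact_Icc.prod isCompact_Icc).measure_lt_top

/-- The constant in the transversality estimate. -/
noncomputable def transConst (γ : ℝ) : ℝ := 4 * Real.pi * 800 / γ ^ 8

theorem transConst_pos {γ : ℝ} (hγ : 0 < γ) : 0 < transConst γ := by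
  have := Real.pi_pos
  unfold transConst
  positivity

/-- The paths that agree with `x` in exactly the first `n` letters. -/
def splitSet (x : ℕ → Fin 2) (n : ℕ) : Set (ℕ → Fin 2) := cylinder x n ∩ {y | x n ≠ y n}

theorem measurableSet_splitSet (x : ℕ → Fin 2) (n : ℕ) : MeasurableSet (splitSet x n) :=
  (measurableSet_cylinder x n).inter
    (measurableSet_eq_fun measurable_const (measurable_pi_apply n)).compl

theorem exists_mem_splitSet {x y : ℕ → Fin 2} (h : y ≠ x) : ∃ n, y ∈ splitSet x n := by
  classical
  have hex : ∃ n, x n ≠ y n := by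
    by_contra hcon
    push Not at hcon
    exact h (funext hcon).symm
  exact ⟨Nat.find hex, fun k hk => not_not.1 (Nat.find_min hex hk), Nat.find_spec hex⟩

theorem measurableSet_near {c : Fin 2 → ℝ} (hc : ∀ i, 0 < c i) (x : ℕ → Fin 2) (r : ℝ) :
    MeasurableSet {z : (ℝ × ℝ) × (ℕ → Fin 2) |
      |clampSeries c z.1 x - clampSeries c z.1 z.2| ≤ r} :=
  measurableSet_le (((measurable_clampSeries hc).comp
    (measurable_fst.prodMk measurable_const)).sub (measurable_clampSeries hc)).abs
    measurable_const

/-- By Tonelli one may fix y first: the parameters bringing the images of x and y within r have area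
at most a constant times r over the weight of the common prefix. Integrating over the cylinder
yields the mass ratio. -/
theorem lintegral_split_le (p : Set.Ioo (0 : ℝ) 1) {c : Fin 2 → ℝ} {γ : ℝ} (hγ : 0 < γ)
    (hγc : ∀ i, γ ≤ c i) {x : ℕ → Fin 2} (hx : Admissible x) (r : ℝ) (n : ℕ) :
    ∫⁻ β, chainLaw p ({y | |clampSeries c β x - clampSeries c β y| ≤ r} ∩ splitSet x n)
      ∂(volume.restrict (paramSet c)) ≤ ENNReal.ofReal (transConst γ * r) * massRatio p c x n := by
  have hc : ∀ i, 0 < c i := fun i => hγ.trans_le (hγc i)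
  set E : Set ((ℝ × ℝ) × (ℕ → Fin 2)) :=
    {z | |clampSeries c z.1 x - clampSeries c z.1 z.2| ≤ r} ∩ Prod.snd ⁻¹' splitSet x n with hE
  have hEm : MeasurableSet E :=
    (measurableSet_near hc x r).inter (measurable_snd (measurableSet_splitSet x n))
  have hw := pathWeight_pos hc x n
  have hslice : ∀ᵐ y ∂(chainLaw p), volume.restrict (paramSet c) ((fun β => (β, y)) ⁻¹' E) ≤
      (cylinder x n).indicator
        (fun _ => ENNReal.ofReal (transConst γ * r / pathWeight c x n)) y := by
    filter_upwards [ae_admissible p] with y hy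
    by_cases hs : y ∈ splitSet x n
    · rw [Set.indicator_of_mem hs.1]
      refine (measure_mono ?_).trans ((volume_near_le hγ hγc hx hy hs.1 hs.2 r).trans
        (ENNReal.ofReal_le_ofReal (le_of_eq ?_)))
      · exact fun β hβ => hβ.1
      · unfold transConst; ring
    · have : (fun β : ℝ × ℝ => (β, y)) ⁻¹' E = ∅ := by
        ext β
        simp only [Set.mem_preimage, Set.mem_empty_iff_false, iff_false]
        exact fun h => hs h.2
      rw [this, measure_empty]
      exact zero_le
  calc _ = ((volume.restrict (paramSet c)).prod (chainLaw p)) E :=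
        (Measure.prod_apply hEm).symm
    _ = ∫⁻ y, volume.restrict (paramSet c) ((fun β => (β, y)) ⁻¹' E) ∂(chainLaw p) :=
        Measure.prod_apply_symm hEm
    _ ≤ _ := lintegral_mono_ae hslice
    _ = ENNReal.ofReal (transConst γ * r / pathWeight c x n) * chainLaw p (cylinder x n) :=
        lintegral_indicator_const (measurableSet_cylinder x n) _
    _ = _ := by
        rw [massRatio, ENNReal.ofReal_div_of_pos hw, div_eq_mul_inv, div_eq_mul_inv]
        ring

theorem massRatio_ne_top (p : Set.Ioo (0 : ℝ) 1) {c : Fin 2 → ℝ} (hc : ∀ i, 0 < c i)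
    (x : ℕ → Fin 2) (n : ℕ) : massRatio p c x n ≠ ⊤ :=
  ENNReal.div_ne_top (measure_ne_top _ _) (ENNReal.ofReal_pos.2 (pathWeight_pos hc x n)).ne'

/-- The energy of a single path with negligible mass, integrated over the parameters. -/
theorem lintegral_near_rpow_le (p : Set.Ioo (0 : ℝ) 1) {c : Fin 2 → ℝ} {γ : ℝ} (hγ : 0 < γ)
    (hγc : ∀ i, γ ≤ c i) {s : ℝ} (hs : 0 < s) (hs1 : s ≤ 1) {x : ℕ → Fin 2} (hx : Admissible x)
    (hx0 : chainLaw p {x} = 0) (r : ℝ) :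
    ∫⁻ β, chainLaw p {y | |clampSeries c β x - clampSeries c β y| ≤ r} ^ s
      ∂(volume.restrict (paramSet c)) ≤
      ENNReal.ofReal (transConst γ * r) ^ s * (volume (paramSet c) + 1) *
        ∑' n, massRatio p c x n ^ s := by
  have hc : ∀ i, 0 < c i := fun i => hγ.trans_le (hγc i)
  set f : ℕ → ℝ × ℝ → ENNReal := fun n β =>
    chainLaw p ({y | |clampSeries c β x - clampSeries c β y| ≤ r} ∩ splitSet x n) with hf
  have hfm : ∀ n, Measurable (f n) := fun n =>
    measurable_measure_prodMk_left ((measurableSet_near hc x r).inter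
      (measurable_snd (measurableSet_splitSet x n)))
  -- The path x itself lies in none of the split sets, so its mass has to vanish.
  have hcover : ∀ β, chainLaw p {y | |clampSeries c β x - clampSeries c β y| ≤ r} ≤
      ∑' n, f n β := by
    intro β
    calc _ ≤ chainLaw p ({x} ∪
          ⋃ n, {y | |clampSeries c β x - clampSeries c β y| ≤ r} ∩ splitSet x n) := by
          refine measure_mono fun y hy => ?_
          by_cases h : y = x
          · exact Or.inl h
          · obtain ⟨n, hn⟩ := exists_mem_splitSet h
            exact Or.inr (Set.mem_iUnion.2 ⟨n, hy, hn⟩)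
      _ ≤ chainLaw p {x} + chainLaw p
          (⋃ n, {y | |clampSeries c β x - clampSeries c β y| ≤ r} ∩ splitSet x n) :=
          measure_union_le _ _
      _ ≤ _ := by rw [hx0, zero_add]; exact measure_iUnion_le _
  calc _ ≤ ∫⁻ β, ∑' n, f n β ^ s ∂(volume.restrict (paramSet c)) :=
        lintegral_mono fun β => (ENNReal.rpow_le_rpow (hcover β) hs.le).trans
          (rpow_tsum_le_tsum_rpow _ hs hs1)
    _ = ∑' n, ∫⁻ β, f n β ^ s ∂(volume.restrict (paramSet c)) :=
        lintegral_tsum fun n => ((hfm n).pow_const s).aemeasurable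
    _ ≤ ∑' n, ENNReal.ofReal (transConst γ * r) ^ s * (volume (paramSet c) + 1) *
          massRatio p c x n ^ s := by
        refine ENNReal.tsum_le_tsum fun n => ?_
        refine (lintegral_rpow_le (ENNReal.mul_ne_top ENNReal.ofReal_ne_top
          (massRatio_ne_top p hc x n)) (hfm n) (lintegral_split_le p hγ hγc hx r n)
          hs hs1).trans (le_of_eq ?_)
        rw [Measure.restrict_apply_univ, ENNReal.mul_rpow_of_nonneg _ _ hs.le]
        ring
    _ = _ := ENNReal.tsum_mul_left

/-- Absolute continuity, and square integrability of the density in the case `s = 1`, for almost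
all parameters in a square on which the weighted transition matrix is contracting. -/
theorem ae_paramSet (p : Set.Ioo (0 : ℝ) 1) {c : Fin 2 → ℝ} (hc : ∀ i, 0 < c i)
    (hc1 : ∀ i, c i ≤ 1) {s : ℝ} (hs : 0 < s) (hs1 : s ≤ 1) (h : charSum p c s < 1) :
    ∀ᵐ β ∂(volume.restrict (paramSet c)), markovGeometricMeasure β.1 β.2 p ≪ volume ∧
      (s = 1 → HasL2Density (markovGeometricMeasure β.1 β.2 p)) := by
  set γ := min (c 0) (c 1) with hγdef
  have hγ : 0 < γ := lt_min (hc 0) (hc 1)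
  have hγc : ∀ i, γ ≤ c i := by
    intro i; fin_cases i
    · exact min_le_left _ _
    · exact min_le_right _ _
  have hsum := tsum_massRatio_lt_top p hc hc1 hs h
  have hMm : ∀ n, Measurable fun x => massRatio p c x n ^ s := fun n =>
    (measurable_massRatio p c n).pow_const s
  rw [← lintegral_tsum fun n => (hMm n).aemeasurable] at hsum
  -- Path weights are at most 1, so an atom at x would keep every mass ratio above its mass and make
  -- the almost surely finite sum diverge.
  have hatom : ∀ᵐ x ∂(chainLaw p), chainLaw p {x} = 0 := by
    filter_upwards [ae_lt_top (Measurable.tsum hMm) hsum.ne] with x hx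
    have ht := ENNReal.tendsto_atTop_zero_of_tsum_ne_top hx.ne
    have hle : ∀ n, chainLaw p {x} ^ s ≤ massRatio p c x n ^ s := by
      intro n
      refine ENNReal.rpow_le_rpow ?_ hs.le
      have h1 : chainLaw p {x} ≤ chainLaw p (cylinder x n) :=
        measure_mono (Set.singleton_subset_iff.2 fun k _ => rfl)
      refine h1.trans ?_
      rw [massRatio, ENNReal.le_div_iff_mul_le (Or.inl
        (ENNReal.ofReal_pos.2 (pathWeight_pos hc x n)).ne') (Or.inl ENNReal.ofReal_ne_top)]
      refine mul_le_of_le_one_right zero_le ?_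
      rw [ENNReal.ofReal_le_one]
      exact pathWeight_le_one (fun i => (hc i).le) hc1 x n
    have h0 : chainLaw p {x} ^ s ≤ 0 := ge_of_tendsto' ht hle
    simpa [hs, hs.le, hs.not_gt] using h0
  have hS : Measurable (Function.uncurry (clampSeries c)) := measurable_clampSeries hc
  have henergy : ∀ r : ℝ, 0 < r → ∫⁻ β, ∫⁻ x,
      chainLaw p {y | |clampSeries c β x - clampSeries c β y| ≤ r} ^ s ∂(chainLaw p)
        ∂(volume.restrict (paramSet c)) ≤
      ENNReal.ofReal (transConst γ / 2) ^ s * (volume (paramSet c) + 1) *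
        (∫⁻ x, ∑' n, massRatio p c x n ^ s ∂(chainLaw p)) * ENNReal.ofReal (2 * r) ^ s := by
    intro r hr
    have hm := (measurable_measure_near hS (chainLaw p) r).pow_const s
    rw [lintegral_lintegral_swap hm.aemeasurable]
    have hT := transConst_pos hγ
    calc _ ≤ ∫⁻ x, ENNReal.ofReal (transConst γ * r) ^ s * (volume (paramSet c) + 1) *
          ∑' n, massRatio p c x n ^ s ∂(chainLaw p) := by
          refine lintegral_mono_ae ?_
          filter_upwards [ae_admissible p, hatom] with x hx hx0
          exact lintegral_near_rpow_le p hγ hγc hs hs1 hx hx0 r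
      _ = ENNReal.ofReal (transConst γ * r) ^ s * (volume (paramSet c) + 1) *
          ∫⁻ x, ∑' n, massRatio p c x n ^ s ∂(chainLaw p) :=
          lintegral_const_mul _ (Measurable.tsum hMm)
      _ = _ := by
          rw [show transConst γ * r = transConst γ / 2 * (2 * r) by ring,
            ENNReal.ofReal_mul (by positivity), ENNReal.mul_rpow_of_nonneg _ _ hs.le]
          ring
  have hC : ENNReal.ofReal (transConst γ / 2) ^ s * (volume (paramSet c) + 1) *
      (∫⁻ x, ∑' n, massRatio p c x n ^ s ∂(chainLaw p)) ≠ ⊤ := by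
    refine ENNReal.mul_ne_top (ENNReal.mul_ne_top ?_ ?_) hsum.ne
    · exact ENNReal.rpow_ne_top_of_nonneg hs.le ENNReal.ofReal_ne_top
    · exact ENNReal.add_ne_top.2 ⟨(volume_paramSet_lt_top c).ne, ENNReal.one_ne_top⟩
  filter_upwards [ae_lintegral_liminf_lt_top hS (chainLaw p) _ hs hC henergy,
    ae_restrict_mem (measurableSet_paramSet c)] with β hβ hmem
  have hser : series β.1 β.2 = clampSeries c β :=
    funext fun x => (clampSeries_of_mem hmem x).symm
  rw [markovGeometricMeasure, hser]
  have hSβ : Measurable (clampSeries c β) := hS.comp measurable_prodMk_left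
  have : IsProbabilityMeasure ((chainLaw p).map (clampSeries c β)) :=
    Measure.isProbabilityMeasure_map hSβ.aemeasurable
  constructor
  · exact absolutelyContinuous_of_liminf_lt_top hs (ae_lt_top
      (Measurable.liminf fun j => (measurable_ballRatio _ j).pow_const s) hβ.ne)
  · intro h1
    refine hasL2Density_of_lintegral_liminf_lt_top ?_
    simpa [h1] using hβ

/-! ### From the characteristic sum to the two parameter regions -/

theorem exists_rat_charSum_lt_one {p : ℝ} (hp : p ∈ Set.Ioo (0 : ℝ) 1) {x y s : ℝ} (hx : 0 < x)
    (hy : 0 < y) (h : charSum p ![x, y] s < 1) :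
    ∃ a b : ℚ, (0 < (a : ℝ) ∧ (a : ℝ) < x) ∧ (0 < (b : ℝ) ∧ (b : ℝ) < y) ∧
      charSum p ![(a : ℝ), (b : ℝ)] s < 1 := by
  have hq : 0 < 1 - p := by linarith [hp.2]
  have hp0 := hp.1
  have hcont : ContinuousAt (fun z : ℝ × ℝ => charSum p ![z.1, z.2] s) (x, y) := by
    simp only [charSum, Matrix.cons_val_zero, Matrix.cons_val_one]
    refine ContinuousAt.add (ContinuousAt.mul continuousAt_const (ContinuousAt.rpow_const
      (ContinuousAt.div continuousAt_const continuousAt_fst hx.ne') ?_))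
      (ContinuousAt.mul continuousAt_const (ContinuousAt.rpow_const
      (ContinuousAt.div continuousAt_const (continuousAt_fst.mul continuousAt_snd)
        (mul_pos hx hy).ne') ?_))
    · exact Or.inl (div_pos hp0 hx).ne'
    · exact Or.inl (div_pos hq (mul_pos hx hy)).ne'
  obtain ⟨ε, hε, hball⟩ := Metric.eventually_nhds_iff.1 (hcont.eventually (gt_mem_nhds h))
  obtain ⟨a, ha1, ha2⟩ := exists_rat_btwn (show max 0 (x - ε) < x from max_lt hx (by linarith))
  obtain ⟨b, hb1, hb2⟩ := exists_rat_btwn (show max 0 (y - ε) < y from max_lt hy (by linarith))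
  rw [max_lt_iff] at ha1 hb1
  refine ⟨a, b, ⟨ha1.1, ha2⟩, ⟨hb1.1, hb2⟩, hball (y := ((a : ℝ), (b : ℝ))) ?_⟩
  rw [Prod.dist_eq, Real.dist_eq, Real.dist_eq]
  exact max_lt (abs_lt.2 ⟨by linarith, by linarith⟩) (abs_lt.2 ⟨by linarith, by linarith⟩)

/-- If the entropy exceeds the Lyapunov exponent, then the characteristic sum is below one for
small exponents. -/
theorem exists_exponent_charSum_lt_one {p : ℝ} (hp : p ∈ Set.Ioo (0 : ℝ) 1) {x y : ℝ}
    (hx : 0 < x) (hy : 0 < y) (h : x * y ^ (1 - p) > p ^ p * (1 - p) ^ (1 - p)) :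
    ∃ k : ℕ, charSum p ![x, y] (1 / ((k : ℝ) + 1)) < 1 := by
  have hq : 0 < 1 - p := by linarith [hp.2]
  have hp0 := hp.1
  have hxy := mul_pos hx hy
  have hlog := Real.log_lt_log (by positivity) h
  rw [Real.log_mul (by positivity) (by positivity), Real.log_mul (by positivity) (by positivity),
    Real.log_rpow hp0, Real.log_rpow hq, Real.log_rpow hy] at hlog
  have hd : HasDerivAt (fun s : ℝ => charSum p ![x, y] s)
      (p * Real.log (p / x) + (1 - p) * Real.log ((1 - p) / (x * y))) 0 := by
    have d1 := ((hasDerivAt_id (0 : ℝ)).const_rpow (div_pos hp0 hx)).const_mul p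
    have d2 := ((hasDerivAt_id (0 : ℝ)).const_rpow (div_pos hq hxy)).const_mul (1 - p)
    exact (d1.add d2).congr_deriv (by simp)
  -- This is the logarithm of the entropy condition; the coefficients p and 1 - p of log x add up to
  -- 1.
  have hneg : p * Real.log (p / x) + (1 - p) * Real.log ((1 - p) / (x * y)) < 0 := by
    rw [Real.log_div hp0.ne' hx.ne', Real.log_div hq.ne' hxy.ne', Real.log_mul hx.ne' hy.ne']
    nlinarith
  have h1 := (hasDerivAt_iff_tendsto_slope.1 hd).eventually (gt_mem_nhds hneg)
  have h2 := (tendsto_one_div_nhdsWithin.mono_right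
    (nhdsWithin_mono 0 fun s (hs : 0 < s) => hs.ne')).eventually h1
  obtain ⟨k, hk⟩ := h2.exists
  refine ⟨k, ?_⟩
  have hk0 : (0 : ℝ) < 1 / ((k : ℝ) + 1) := by positivity
  have h0 : charSum p ![x, y] 0 = 1 := by simp [charSum]
  rw [slope_def_field, sub_zero, h0, div_neg_iff] at hk
  rcases hk with hk | hk
  · linarith [hk.2]
  · linarith [hk.1]

theorem charSum_one_lt_one {p x y : ℝ} (hx : 0 < x) (hy : 0 < y)
    (h : (x - p ^ 2) * y > (1 - p) ^ 2) : charSum p ![x, y] 1 < 1 := by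
  simp only [charSum, Matrix.cons_val_zero, Matrix.cons_val_one, Real.rpow_one]
  have e : p * (p / x) + (1 - p) * ((1 - p) / (x * y)) =
      (p ^ 2 * y + (1 - p) ^ 2) / (x * y) := by
    field_simp
  rw [e, div_lt_one (mul_pos hx hy)]
  linarith

/-- By continuity each good parameter lies in a square whose rational lower corner also has
characteristic sum below one. There are countably many such squares, so their exceptional null sets
can be united. -/
theorem ae_of_charSum_lt_one (p : Set.Ioo (0 : ℝ) 1) {s : ℝ} (hs : 0 < s) (hs1 : s ≤ 1) :
    ∀ᵐ β : ℝ × ℝ, β.1 ∈ Set.Ioo (0 : ℝ) 0.739 → β.2 ∈ Set.Ioo (0 : ℝ) 0.739 →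
      charSum p ![β.1, β.2] s < 1 → markovGeometricMeasure β.1 β.2 p ≪ volume ∧
        (s = 1 → HasL2Density (markovGeometricMeasure β.1 β.2 p)) := by
  have hall : ∀ᵐ β : ℝ × ℝ, ∀ a b : ℚ, (0 < (a : ℝ) ∧ (a : ℝ) ≤ 1) → (0 < (b : ℝ) ∧ (b : ℝ) ≤ 1) →
      charSum p ![(a : ℝ), (b : ℝ)] s < 1 → β ∈ paramSet ![(a : ℝ), (b : ℝ)] →
      markovGeometricMeasure β.1 β.2 p ≪ volume ∧
        (s = 1 → HasL2Density (markovGeometricMeasure β.1 β.2 p)) := by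
    rw [ae_all_iff]; intro a
    rw [ae_all_iff]; intro b
    by_cases hab : (0 < (a : ℝ) ∧ (a : ℝ) ≤ 1) ∧ (0 < (b : ℝ) ∧ (b : ℝ) ≤ 1) ∧
        charSum p ![(a : ℝ), (b : ℝ)] s < 1
    · obtain ⟨ha, hb, hlt⟩ := hab
      have := ae_paramSet p (c := ![(a : ℝ), (b : ℝ)])
        (by intro i; fin_cases i; exacts [ha.1, hb.1])
        (by intro i; fin_cases i; exacts [ha.2, hb.2]) hs hs1 hlt
      rw [ae_restrict_iff' (measurableSet_paramSet _)] at this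
      filter_upwards [this] with β hβ _ _ _ hmem using hβ hmem
    · exact Filter.Eventually.of_forall fun β ha hb hlt => absurd ⟨ha, hb, hlt⟩ hab
  filter_upwards [hall] with β hβ h0 h1 hlt
  obtain ⟨a, b, ha, hb, hab⟩ := exists_rat_charSum_lt_one p.2 h0.1 h1.1 hlt
  refine hβ a b ⟨ha.1, ?_⟩ ⟨hb.1, ?_⟩ hab ⟨⟨ha.2.le, h0.2.le⟩, hb.2.le, h1.2.le⟩
  · linarith [ha.2, h0.2]
  · linarith [hb.2, h1.2]

end MarkovGeometric

theorem theorem3p2 (p : ℝ) (hp : p ∈ Set.Ioo (0 : ℝ) 1) :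
    (∀ᵐ β : ℝ × ℝ ∂volume, β.1 ∈ Set.Ioo (0 : ℝ) 0.739 → β.2 ∈ Set.Ioo (0 : ℝ) 0.739 →
      β.1 * β.2 ^ (1 - p) > p ^ p * (1 - p) ^ (1 - p) →
        MarkovGeometric.markovGeometricMeasure β.1 β.2 ⟨p, hp⟩ ≪ volume) ∧
    (∀ᵐ β : ℝ × ℝ ∂volume, β.1 ∈ Set.Ioo (0 : ℝ) 0.739 → β.2 ∈ Set.Ioo (0 : ℝ) 0.739 →
      (β.1 - p ^ 2) * β.2 > (1 - p) ^ 2 →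
        MarkovGeometric.HasL2Density
          (MarkovGeometric.markovGeometricMeasure β.1 β.2 ⟨p, hp⟩)) := by
  constructor
  -- The admissible exponent depends on β, so the null sets for all exponents 1 / (k + 1) are
  -- discarded at once.
  · have h := ae_all_iff.2 fun k : ℕ => MarkovGeometric.ae_of_charSum_lt_one ⟨p, hp⟩
      (s := 1 / ((k : ℝ) + 1)) (by positivity)
      ((div_le_one (by positivity)).2 (by linarith [k.cast_nonneg (α := ℝ)]))
    filter_upwards [h] with β hβ h0 h1 hent
    obtain ⟨k, hk⟩ := MarkovGeometric.exists_exponent_charSum_lt_one hp h0.1 h1.1 hent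
    exact (hβ k h0 h1 hk).1
  · filter_upwards [MarkovGeometric.ae_of_charSum_lt_one ⟨p, hp⟩ one_pos le_rfl]
      with β hβ h0 h1 hL2
    exact (hβ h0 h1 (MarkovGeometric.charSum_one_lt_one h0.1 h1.1 hL2)).2 rfl
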